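/- **Setting (East model).** Fix $q\in(0,1)$, let $\nu$ be the probability measure on $\{0,1\}$ with $\nu(0)=q$, $\nu(1)=1-q$, and let $\mu=\prod_{x\in\mathbb Z}\nu$ be the product measure on $\Omega=\{0,1\}^{\mathbb Z}$ (a site $x$ with $\omega_x=0$ is called empty). For $x\in\mathbb Z$ let $c_x(\omega)=1$ if $\omega_{x+1}=0$ and $c_x(\omega)=0$ otherwise. The East model is the Markov process on $\Omega$, reversible with respect to $\mu$, in which each site $x$ is refreshed at rate $c_x(\omega)$ with a new value sampled from $\nu$. Its generator $\mathcal L$ is the self-adjoint operator on $L^2(\Omega,\mu)$ that is the closure of the operator $$\mathcal L\varphi(\omega)=\sum_{x\in\mathbb Z}c_x(\omega)\Big(\int\varphi(\omega^{x,s})\,d\nu(s)-\varphi(\omega)\Big)$$ on functions $\varphi$ of finitely many coordinates, where $\omega^{x,s}$ is $\omega$ with the value at $x$ replaced by $s$. Its Dirichlet form is $\mathcal D(f)=\sum_{x\in\mathbb Z}\mu\big(c_x\operatorname{Var}_x(f)\big)$, where $\operatorname{Var}_x(f)$ is the variance of $f$ with respect to $\omega_x\sim\nu$, the other coordinates being held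 fixed. The spectral gap is $$\operatorname{gap}(q)=\inf\Big\{\frac{\mathcal D(f)}{\operatorname{Var}_\mu(f)}:\ f\in \mathrm{Dom}(\mathcal L),\ f \text{ not } \mu\text{-a.e. constant}\Big\}.$$ **Theorem.** 1. For every $q\in(0,1)$, $\operatorname{gap}(q)>0$. 2. For every $\delta\in(0,1)$ there is a constant $C_\delta>0$, depending only on $\delta$, such that for all $q\in(0,1)$ $$\operatorname{gap}(q)\ \ge\ C_\delta\, q^{\log_2(1/q)/(2-\delta)} .$$ 3. $$\lim_{q\downarrow 0}\frac{\log(1/\operatorname{gap}(q))}{(\log(1/q))^2}=\frac1{2\log 2},$$ where $\log$ is the natural logarithm. -/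

import Mathlib

open MeasureTheory ProbabilityTheory Filter Topology
open scoped ENNReal

namespace EastModel

/-- Configurations `ω ∈ {0,1}^ℤ`; `ω x = 0` means that the site `x` is empty and `ω x = 1` that it
is occupied. -/
abbrev Config : Type := ℤ → Fin 2

/-- The single-site measure `ν`: a site is empty with probability `q` and occupied with
probability `1 - q`. -/
noncomputable abbrev siteMeasure (q : unitInterval) : Measure (Fin 2) :=
  bernoulliMeasure (0 : Fin 2) (1 : Fin 2) q

/-- The product measure `μ = ∏_{x ∈ ℤ} ν` on `{0,1}^ℤ`. -/
noncomputable abbrev equilibrium (q : unitInterval) : Measure Config :=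
  Measure.infinitePi (fun _ : ℤ => siteMeasure q)

/-- The event `{c_x = 1}` that the East constraint at `x` is satisfied: the right neighbour of `x`
is empty. -/
def constraintSet (x : ℤ) : Set Config := {ω | ω (x + 1) = 0}

/-- The local variance `Var_x(f)(ω)`: the variance of `f` with respect to the variable `ω x`,
distributed according to `ν`, when all the other variables are held fixed. -/
noncomputable def localVariance (q : unitInterval) (x : ℤ) (f : Config → ℝ) (ω : Config) : ℝ≥0∞ :=
  evariance (fun s => f (Function.update ω x s)) (siteMeasure q)

/-- The Dirichlet form `𝓓(f) = ∑_x μ(c_x Var_x(f))`, with values in `[0, ∞]`. -/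
noncomputable def dirichletForm (q : unitInterval) (f : Config → ℝ) : ℝ≥0∞ :=
  ∑' x : ℤ, ∫⁻ ω in constraintSet x, localVariance q x f ω ∂(equilibrium q)

/-- The action of the generator on a function `φ` that depends on finitely many coordinates,
`(𝓛 φ)(ω) = ∑_x c_x(ω) (∫ φ(ω with ω_x replaced by s) dν(s) - φ(ω))`:
each site `x` is refreshed from `ν` at rate `c_x`. The term of a site `x` vanishes
when `φ` does not depend on the coordinate `x`, so that the sum is finite. -/
noncomputable def localGenerator (q : unitInterval) (φ : Config → ℝ) (ω : Config) : ℝ :=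
  ∑ᶠ x : ℤ, (constraintSet x).indicator
    (fun ω => (∫ s, φ (Function.update ω x s) ∂(siteMeasure q)) - φ ω) ω

/-- The graph, in `L²(μ) × L²(μ)`, of the generator restricted to the functions that depend on
finitely many coordinates. -/
def localGeneratorGraph (q : unitInterval) :
    Set (Lp ℝ 2 (equilibrium q) × Lp ℝ 2 (equilibrium q)) :=
  {F | ∃ φ : Config → ℝ, (∃ Λ : Finset ℤ, DependsOn φ (Λ : Set ℤ)) ∧
    F.1 =ᵐ[equilibrium q] φ ∧ F.2 =ᵐ[equilibrium q] localGenerator q φ}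

/-- The domain `Dom(𝓛)` of the generator in `L²(μ)`. The self-adjoint generator is the closure of
its restriction to the functions of finitely many coordinates; its graph is the closure of
`localGeneratorGraph`. -/
def generatorDomain (q : unitInterval) : Set (Lp ℝ 2 (equilibrium q)) :=
  {f | ∃ g, (f, g) ∈ closure (localGeneratorGraph q)}

/-- The spectral gap `inf {𝓓(f) / Var(f) : f ∈ Dom(𝓛), f not μ-a.e. constant}`. The infimum is
taken in `[0, ∞]` and then read as a real number (with `∞` read as `0`). -/
noncomputable def spectralGap (q : unitInterval) : ℝ :=
  (⨅ f ∈ {f ∈ generatorDomain q | ¬ ∃ a : ℝ, f =ᵐ[equilibrium q] fun _ => a},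
    dirichletForm q f / evariance f (equilibrium q)).toReal

end EastModel

/-! Lower bound, by bisection. Consider an interval of length `n` followed by an empty site, and
write `L = log (1/p)`. Split the interval into a left block and a right block. If one of the first
`d` sites of the right block is empty, the left block can relax as part of a shorter interval that
also ends at an empty site. The two-block inequality `IsAveraging.cvar_apply_le_of_event` turns this
into `Poincare.step`: the length almost doubles at the cost of a factor `4 / r`, where `r` is the
probability of finding that empty site. With `d` about `η N`, the factor at scale `(2 - η) ^ i` is
of order `1 / (p (2 - η) ^ i)`. About `L / log (2 - η)` steps reach scale `1 / p`, and the product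
is `exp (L² / (2 log (2 - η)) + O(L + 1))`.

Beyond that scale, blocks of length of order `1 / p` are rarely full, and `chain_le` treats
arbitrarily many of them with a constant loss. Approximation by local functions passes to `ℤ`
(`evariance_le_of_poincare`); the required empty boundary site costs a factor `q`. Taking `η` small
gives the first two claims and the upper half of the limit.

Upper bound, by a bottleneck. The test function is the indicator that the empty sites of `[-2^n,
-1]` form a set built by at most `n` insertions at distances `2^(n-1), 2^(n-2), ..., 1` from earlier
points. A legal flip can cross the boundary of this event only where all `n` insertions have been
used (`mem_goodSets_of_not_iff`). There are at most `n^n 2^(n(n-1)/2)` such sets, each empty with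
probability `q^n`. For `2^n` of order `1/q`, energy against entropy gives a gap of at most `exp (-L²
/ (2 log 2) + O(L log L))`, with `L = log (1/q)`. -/

namespace EastModel

/-! ### Averaging operators and conditional variances -/

section Averaging

variable {Ω : Type*}

/-- Conditional-expectation-like operators on real functions, acting pointwise. -/
structure IsAveraging (E : Module.End ℝ (Ω → ℝ)) : Prop where
  nonneg : ∀ f, 0 ≤ f → 0 ≤ E f
  one : E 1 = 1
  pull : ∀ f g, E (f * E g) = E f * E g

/-- The conditional variance attached to an averaging operator. -/
def cvar (E : Module.End ℝ (Ω → ℝ)) (f : Ω → ℝ) : Ω → ℝ := E (f * f) - E f * E f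

namespace IsAveraging

variable {E E₁ E₂ : Module.End ℝ (Ω → ℝ)}

protected theorem id : IsAveraging (1 : Module.End ℝ (Ω → ℝ)) :=
  ⟨fun _ h => h, rfl, fun _ _ => rfl⟩

theorem mono (h : IsAveraging E) {f g : Ω → ℝ} (hfg : f ≤ g) : E f ≤ E g := by
  have := h.nonneg (g - f) (sub_nonneg.2 hfg)
  rwa [map_sub, sub_nonneg] at this

theorem idem (h : IsAveraging E) (f : Ω → ℝ) : E (E f) = E f := by
  have := h.pull 1 f
  rwa [one_mul, h.one, one_mul] at this

theorem pull_left (h : IsAveraging E) (f : Ω → ℝ) {g : Ω → ℝ} (hg : E g = g) :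
    E (g * f) = g * E f := by
  have := h.pull f g
  rwa [hg, mul_comm, mul_comm (E f)] at this

theorem mul (h₁ : IsAveraging E₁) (h₂ : IsAveraging E₂) (hc : Commute E₁ E₂) :
    IsAveraging (E₁ * E₂) where
  nonneg f hf := h₁.nonneg _ (h₂.nonneg _ hf)
  one := by rw [Module.End.mul_apply, h₂.one, h₁.one]
  pull f g := by
    have e : E₁ (E₂ g) = E₂ (E₁ g) := LinearMap.congr_fun hc.eq g
    simp only [Module.End.mul_apply]
    rw [e, h₂.pull, ← e, h₁.pull]

theorem cvar_eq (h : IsAveraging E) (f : Ω → ℝ) :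
    cvar E f = E ((f - E f) * (f - E f)) := by
  have e : (f - E f) * (f - E f) = f * f - (2 : ℝ) • (f * E f) + E f * E f := by
    ext ω; simp; ring
  rw [e, map_add, map_sub, map_smul, h.pull, h.pull_left _ (h.idem f), h.idem, cvar]
  ext ω; simp; ring

theorem cvar_nonneg (h : IsAveraging E) (f : Ω → ℝ) : 0 ≤ cvar E f := by
  rw [h.cvar_eq]
  exact h.nonneg _ fun ω => mul_self_nonneg _

theorem sq_le (h : IsAveraging E) (f : Ω → ℝ) : E f * E f ≤ E (f * f) :=
  sub_nonneg.1 (h.cvar_nonneg f)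

theorem cvar_le (E : Module.End ℝ (Ω → ℝ)) (f : Ω → ℝ) : cvar E f ≤ E (f * f) :=
  sub_le_self _ fun _ => mul_self_nonneg _

theorem apply_cvar (h : IsAveraging E) (f : Ω → ℝ) : E (cvar E f) = cvar E f := by
  rw [h.cvar_eq, h.idem]

theorem cauchySchwarz (h : IsAveraging E) (f g : Ω → ℝ) :
    E (f * g) * E (f * g) ≤ E (f * f) * E (g * g) := by
  intro ω
  have key : ∀ t : ℝ, 0 ≤ E (g * g) ω * (t * t) + (-2 * E (f * g) ω) * t + E (f * f) ω := by
    intro t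
    have e : (f - t • g) * (f - t • g)
        = f * f - (2 * t) • (f * g) + (t * t) • (g * g) := by
      ext ω; simp; ring
    have := h.nonneg ((f - t • g) * (f - t • g)) (fun ω => mul_self_nonneg _) ω
    rw [e] at this
    simp only [map_add, map_sub, map_smul, Pi.add_apply, Pi.sub_apply, Pi.smul_apply,
      Pi.zero_apply, smul_eq_mul] at this
    linarith
  have := discrim_le_zero key
  simp only [discrim, Pi.mul_apply] at this ⊢
  nlinarith

theorem cvar_add_le (h : IsAveraging E) (f g : Ω → ℝ) :
    cvar E (f + g) ≤ (2 : ℝ) • cvar E f + (2 : ℝ) • cvar E g := by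
  have e : (f + g - E (f + g)) * (f + g - E (f + g))
      ≤ (2 : ℝ) • ((f - E f) * (f - E f)) + (2 : ℝ) • ((g - E g) * (g - E g)) := by
    intro ω
    simp only [map_add, Pi.mul_apply, Pi.sub_apply, Pi.add_apply, Pi.smul_apply, smul_eq_mul]
    nlinarith [sq_nonneg ((f ω - E f ω) - (g ω - E g ω))]
  have := h.mono e
  rwa [← h.cvar_eq, map_add, map_smul, map_smul, ← h.cvar_eq, ← h.cvar_eq] at this

/-- Law of total variance; the cross terms telescope, so no commutation is needed. -/
theorem cvar_mul (E₁ E₂ : Module.End ℝ (Ω → ℝ)) (f : Ω → ℝ) :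
    cvar (E₁ * E₂) f = E₁ (cvar E₂ f) + cvar E₁ (E₂ f) := by
  simp [cvar, Module.End.mul_apply]

theorem apply_cvar_le_cvar_mul (h₁ : IsAveraging E₁) (f : Ω → ℝ) :
    E₁ (cvar E₂ f) ≤ cvar (E₁ * E₂) f := by
  rw [cvar_mul]
  exact le_add_of_nonneg_right (h₁.cvar_nonneg _)

/-- Convexity of the variance: Jensen for `E₂` applied to `f - E₁ f`. -/
theorem cvar_apply_le (h₁ : IsAveraging E₁) (h₂ : IsAveraging E₂) (hc : Commute E₁ E₂)
    (f : Ω → ℝ) : cvar E₁ (E₂ f) ≤ E₂ (cvar E₁ f) := by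
  have e : ∀ g, E₁ (E₂ g) = E₂ (E₁ g) := fun g => LinearMap.congr_fun hc.eq g
  rw [h₁.cvar_eq, h₁.cvar_eq f, e, ← map_sub, ← e]
  exact h₁.mono (h₂.sq_le _)

/-- Two-block inequality: the variance over the first block of the average over the second one is
controlled by the variance over the first block when an event `A` of the second block
occurs. -/
theorem cvar_apply_le_of_event (h₁ : IsAveraging E₁) (h₂ : IsAveraging E₂)
    (hc : Commute E₁ E₂) {A : Ω → ℝ} (hA : A * A = A) (hA₁ : E₁ A = A) {p : ℝ} (hp : 0 < p)
    (hA₂ : E₂ A = p • 1) (f : Ω → ℝ) :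
    cvar E₁ (E₂ f) ≤ (2 / p) • E₂ (A * cvar E₁ f) + (2 * (1 / p - 1)) • E₁ (cvar E₂ f) := by
  have e : ∀ g, E₁ (E₂ g) = E₂ (E₁ g) := fun g => LinearMap.congr_fun hc.eq g
  have hp' : p ≠ 0 := hp.ne'
  -- `B` has mean zero and second moment `1 / p - 1` under `E₂`. Hence `E₂ f` differs from the
  -- conditional mean given `A`, that is `p⁻¹ E₂ (A f)`, by `E₂ (B (f - E₂ f))`, which
  -- Cauchy–Schwarz controls by `cvar E₂ f`.
  set B : Ω → ℝ := 1 - p⁻¹ • A with hB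
  have hB₂ : E₂ B = 0 := by
    rw [hB, map_sub, map_smul, hA₂, h₂.one, smul_smul, inv_mul_cancel₀ hp', one_smul, sub_self]
  have hBB : E₂ (B * B) = (1 / p - 1) • 1 := by
    have : B * B = 1 - (2 * p⁻¹) • A + (p⁻¹ * p⁻¹) • A := by
      conv_rhs => rw [← hA]
      ext ω
      have := congrFun hA ω
      simp only [Pi.mul_apply] at this
      simp only [hB, Pi.mul_apply, Pi.sub_apply, Pi.add_apply, Pi.smul_apply, smul_eq_mul,
        Pi.one_apply]
      linear_combination (2 * p⁻¹) * this
    rw [this, map_add, map_sub, map_smul, map_smul, hA₂, h₂.one]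
    ext ω
    simp only [Pi.sub_apply, Pi.add_apply, Pi.smul_apply, smul_eq_mul, Pi.one_apply]
    field_simp
    ring
  have hsplit : E₂ f = p⁻¹ • E₂ (A * f) + E₂ (B * (f - E₂ f)) := by
    have : B * (f - E₂ f) = f - p⁻¹ • (A * f) - B * E₂ f := by
      ext ω; simp [hB]; ring
    rw [this, map_sub, map_sub, map_smul, h₂.pull, hB₂]
    simp
  have hk : cvar E₁ (E₂ (B * (f - E₂ f))) ≤ (1 / p - 1) • E₁ (cvar E₂ f) := by
    refine (cvar_le E₁ _).trans ?_
    have := h₁.mono (h₂.cauchySchwarz B (f - E₂ f))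
    rw [hBB, ← h₂.cvar_eq] at this
    refine this.trans (le_of_eq ?_)
    rw [smul_mul_assoc, one_mul, map_smul]
  -- Cauchy–Schwarz against `A`: its mass `p` cancels one of the two factors `p⁻¹`.
  have hh : cvar E₁ (p⁻¹ • E₂ (A * f)) ≤ (1 / p) • E₂ (A * cvar E₁ f) := by
    have e1 : E₁ (p⁻¹ • E₂ (A * f)) = p⁻¹ • E₂ (A * E₁ f) := by
      rw [map_smul, e, h₁.pull_left f hA₁]
    have e2 : p⁻¹ • E₂ (A * f) - p⁻¹ • E₂ (A * E₁ f) = p⁻¹ • E₂ (A * (A * (f - E₁ f))) := by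
      rw [← smul_sub, ← map_sub, ← mul_sub, ← mul_assoc, hA]
    have e3 := h₂.cauchySchwarz A (A * (f - E₁ f))
    rw [hA, hA₂] at e3
    have e4 : A * (f - E₁ f) * (A * (f - E₁ f)) = A * ((f - E₁ f) * (f - E₁ f)) := by
      conv_rhs => rw [← hA]
      ring
    rw [h₁.cvar_eq, e1, e2]
    have e5 : p⁻¹ • E₂ (A * (A * (f - E₁ f))) * p⁻¹ • E₂ (A * (A * (f - E₁ f)))
        ≤ (1 / p) • E₂ (A * ((f - E₁ f) * (f - E₁ f))) := by
      intro ω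
      have := e3 ω
      rw [e4] at this
      simp only [Pi.mul_apply, Pi.smul_apply, smul_eq_mul, Pi.one_apply, mul_one] at this ⊢
      have h3 : p⁻¹ * p⁻¹ * (p * (E₂ (A * ((f - E₁ f) * (f - E₁ f)))) ω)
          = 1 / p * (E₂ (A * ((f - E₁ f) * (f - E₁ f)))) ω := by
        field_simp
      rw [← h3]
      calc _ = p⁻¹ * p⁻¹ * ((E₂ (A * (A * (f - E₁ f)))) ω * (E₂ (A * (A * (f - E₁ f)))) ω) := by
            ring
        _ ≤ _ := mul_le_mul_of_nonneg_left this (by positivity)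
    refine (h₁.mono e5).trans (le_of_eq ?_)
    rw [map_smul, e, h₁.pull_left _ hA₁, ← h₁.cvar_eq]
  have := h₁.cvar_add_le (p⁻¹ • E₂ (A * f)) (E₂ (B * (f - E₂ f)))
  rw [← hsplit] at this
  intro ω
  have t1 := this ω
  have t2 := hh ω
  have t3 := hk ω
  simp only [Pi.add_apply, Pi.smul_apply, smul_eq_mul] at t1 t2 t3 ⊢
  have : 2 / p * E₂ (A * cvar E₁ f) ω = 2 * (1 / p * E₂ (A * cvar E₁ f) ω) := by ring
  rw [this]
  linarith

end IsAveraging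

end Averaging

/-! ### Site and block averages, local energies -/

/-- Average over the variable at the site `x`, which is empty with probability `p`. -/
def siteAvg (p : ℝ) (x : ℤ) : Module.End ℝ (Config → ℝ) where
  toFun f ω := p * f (Function.update ω x 0) + (1 - p) * f (Function.update ω x 1)
  map_add' f g := by ext ω; simp; ring
  map_smul' c f := by ext ω; simp; ring

theorem siteAvg_apply (p : ℝ) (x : ℤ) (f : Config → ℝ) (ω : Config) :
    siteAvg p x f ω = p * f (Function.update ω x 0) + (1 - p) * f (Function.update ω x 1) := rfl

/-- Average over the variables in `[a, a + n)`. -/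
def blockAvg (p : ℝ) (a : ℤ) : ℕ → Module.End ℝ (Config → ℝ)
  | 0 => 1
  | n + 1 => blockAvg p a n * siteAvg p (a + n)

/-- Indicator of the event that the site `x` is empty. -/
def emp (x : ℤ) (ω : Config) : ℝ := if ω x = 0 then 1 else 0

theorem emp_mul_self (x : ℤ) : emp x * emp x = emp x := by
  ext ω; simp [emp]

theorem emp_nonneg (x : ℤ) : 0 ≤ emp x := by
  intro ω; simp only [emp, Pi.zero_apply]; split_ifs <;> norm_num

theorem emp_le_one (x : ℤ) : emp x ≤ 1 := by
  intro ω; simp only [emp, Pi.one_apply]; split_ifs <;> norm_num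

/-- Indicator of the event that all the sites of `[a, a + n)` are occupied. -/
def full (a : ℤ) (n : ℕ) : Config → ℝ := ∏ i ∈ Finset.range n, (1 - emp (a + i))

theorem full_zero (a : ℤ) : full a 0 = 1 := by simp [full]

theorem full_succ (a : ℤ) (n : ℕ) : full a (n + 1) = full a n * (1 - emp (a + n)) := by
  simp [full, Finset.prod_range_succ]

theorem full_mul_self (a : ℤ) (n : ℕ) : full a n * full a n = full a n := by
  rw [full, ← Finset.prod_mul_distrib]
  refine Finset.prod_congr rfl fun i _ => ?_
  have := emp_mul_self (a + i)
  linear_combination this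

theorem full_nonneg (a : ℤ) (n : ℕ) : 0 ≤ full a n := by
  induction n with
  | zero => rw [full_zero]; exact zero_le_one
  | succ n ih =>
    rw [full_succ]
    exact fun ω => mul_nonneg (ih ω) (sub_nonneg.2 (emp_le_one _ ω))

theorem full_le_one (a : ℤ) (n : ℕ) : full a n ≤ 1 := by
  induction n with
  | zero => rw [full_zero]
  | succ n ih =>
    rw [full_succ]
    refine fun ω => mul_le_one₀ (ih ω) (sub_nonneg.2 (emp_le_one _ ω)) ?_
    exact sub_le_self _ (emp_nonneg _ ω)

/-- The density of the Dirichlet form at the site `x`. -/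
def siteEnergy (p : ℝ) (x : ℤ) (f : Config → ℝ) : Config → ℝ :=
  emp (x + 1) * cvar (siteAvg p x) f

/-- The density of the Dirichlet form in `[a, a + n)`. -/
def energy (p : ℝ) (a : ℤ) (n : ℕ) (f : Config → ℝ) : Config → ℝ :=
  ∑ i ∈ Finset.range n, siteEnergy p (a + i) f

theorem energy_add (p : ℝ) (a : ℤ) (m n : ℕ) (f : Config → ℝ) :
    energy p a (m + n) f = energy p a m f + energy p (a + m) n f := by
  simp [energy, Finset.sum_range_add, add_assoc]

theorem siteAvg_commute (p : ℝ) (x y : ℤ) : Commute (siteAvg p x) (siteAvg p y) := by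
  rcases eq_or_ne x y with rfl | hxy
  · exact Commute.refl _
  · refine LinearMap.ext fun f => ?_
    ext ω
    simp only [Module.End.mul_apply, siteAvg_apply, Function.update_comm hxy]
    ring

theorem siteAvg_blockAvg_commute (p : ℝ) (x a : ℤ) (n : ℕ) :
    Commute (siteAvg p x) (blockAvg p a n) := by
  induction n with
  | zero => exact Commute.one_right _
  | succ n ih => exact ih.mul_right (siteAvg_commute p x _)

theorem blockAvg_commute (p : ℝ) (a b : ℤ) (m n : ℕ) :
    Commute (blockAvg p a m) (blockAvg p b n) := by
  induction m with
  | zero => exact Commute.one_left _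
  | succ m ih => exact ih.mul_left (siteAvg_blockAvg_commute p _ b n)

theorem blockAvg_succ (p : ℝ) (a : ℤ) (n : ℕ) :
    blockAvg p a (n + 1) = blockAvg p a n * siteAvg p (a + n) := rfl

theorem blockAvg_zero (p : ℝ) (a : ℤ) : blockAvg p a 0 = 1 := rfl

theorem blockAvg_one (p : ℝ) (a : ℤ) : blockAvg p a 1 = siteAvg p a := by
  simp [blockAvg_succ, blockAvg_zero]

theorem blockAvg_add (p : ℝ) (a : ℤ) (m n : ℕ) :
    blockAvg p a (m + n) = blockAvg p a m * blockAvg p (a + m) n := by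
  induction n with
  | zero => simp [blockAvg_zero]
  | succ n ih =>
    rw [← add_assoc, blockAvg_succ, ih, blockAvg_succ, mul_assoc]
    push_cast
    rw [add_assoc]

theorem siteAvg_emp_self (p : ℝ) (x : ℤ) : siteAvg p x (emp x) = p • 1 := by
  ext ω; simp [siteAvg_apply, emp]

theorem siteAvg_emp_of_ne (p : ℝ) {x y : ℤ} (h : y ≠ x) : siteAvg p x (emp y) = emp y := by
  ext ω
  simp only [siteAvg_apply, emp, Function.update_of_ne h]
  ring

theorem isAveraging_siteAvg {p : ℝ} (hp : p ∈ Set.Icc (0 : ℝ) 1) (x : ℤ) :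
    IsAveraging (siteAvg p x) where
  nonneg f hf ω := add_nonneg (mul_nonneg hp.1 (hf _)) (mul_nonneg (sub_nonneg.2 hp.2) (hf _))
  one := by ext ω; simp [siteAvg_apply]
  pull f g := by ext ω; simp [siteAvg_apply]; ring

theorem isAveraging_blockAvg {p : ℝ} (hp : p ∈ Set.Icc (0 : ℝ) 1) (a : ℤ) (n : ℕ) :
    IsAveraging (blockAvg p a n) := by
  induction n with
  | zero => exact IsAveraging.id
  | succ n ih =>
    exact ih.mul (isAveraging_siteAvg hp _) (siteAvg_blockAvg_commute p _ _ _).symm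

section

variable {p : ℝ}

theorem blockAvg_emp (p : ℝ) (a : ℤ) (n : ℕ) {y : ℤ}
    (hy : y < a ∨ a + n ≤ y) : blockAvg p a n (emp y) = emp y := by
  induction n with
  | zero => rfl
  | succ n ih =>
    rw [blockAvg_succ, Module.End.mul_apply, siteAvg_emp_of_ne, ih]
    · push_cast at hy; omega
    · push_cast at hy; omega

theorem blockAvg_full_of_disjoint (hp : p ∈ Set.Icc (0 : ℝ) 1) (a b : ℤ) (m n : ℕ)
    (h : a + m ≤ b ∨ b + n ≤ a) : blockAvg p a m (full b n) = full b n := by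
  induction n with
  | zero => rw [full_zero, (isAveraging_blockAvg hp a m).one]
  | succ n ih =>
    have h1 : blockAvg p a m (full b n) = full b n := ih (by push_cast at h; omega)
    rw [full_succ, (isAveraging_blockAvg hp a m).pull_left _ h1, map_sub,
      (isAveraging_blockAvg hp a m).one, blockAvg_emp p]
    push_cast at h; omega

theorem blockAvg_full (hp : p ∈ Set.Icc (0 : ℝ) 1) (a : ℤ) (n : ℕ) :
    blockAvg p a n (full a n) = (1 - p) ^ n • (1 : Config → ℝ) := by
  induction n with
  | zero => simp [full_zero, blockAvg_zero]
  | succ n ih =>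
    have h1 : siteAvg p (a + n) (full a n) = full a n := by
      rw [← blockAvg_one, blockAvg_full_of_disjoint hp _ _ _ _ (Or.inr le_rfl)]
    have hS := isAveraging_siteAvg hp (a + n)
    have h2 : full a n * (1 - p • (1 : Config → ℝ)) = (1 - p) • full a n := by
      ext ω; simp; ring
    rw [full_succ, blockAvg_succ, Module.End.mul_apply, hS.pull_left _ h1, map_sub, hS.one,
      siteAvg_emp_self, h2, map_smul, ih, smul_smul, pow_succ, mul_comm]

theorem siteEnergy_nonneg (hp : p ∈ Set.Icc (0 : ℝ) 1) (x : ℤ) (f : Config → ℝ) :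
    0 ≤ siteEnergy p x f :=
  fun ω => mul_nonneg (emp_nonneg _ ω) ((isAveraging_siteAvg hp x).cvar_nonneg f ω)

theorem energy_nonneg (hp : p ∈ Set.Icc (0 : ℝ) 1) (a : ℤ) (n : ℕ) (f : Config → ℝ) :
    0 ≤ energy p a n f :=
  Finset.sum_nonneg fun _ _ => siteEnergy_nonneg hp _ f

theorem energy_le_add (hp : p ∈ Set.Icc (0 : ℝ) 1) (a : ℤ) (m n : ℕ) (f : Config → ℝ) :
    energy p a m f ≤ energy p a (m + n) f := by
  rw [energy_add]
  exact le_add_of_nonneg_right (energy_nonneg hp _ _ f)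

theorem energy_le_add' (hp : p ∈ Set.Icc (0 : ℝ) 1) (a : ℤ) (m n : ℕ) (f : Config → ℝ) :
    energy p (a + m) n f ≤ energy p a (m + n) f := by
  rw [energy_add]
  exact le_add_of_nonneg_left (energy_nonneg hp _ _ f)

/-! ### Poincaré inequalities on intervals: the bisection step -/

/-- Poincaré inequality on the intervals `[a, a + n)` with an empty site at `a + n`. -/
def Poincare (p : ℝ) (n : ℕ) (C : ℝ) : Prop :=
  ∀ (a : ℤ) (f : Config → ℝ), emp (a + n) * cvar (blockAvg p a n) f ≤
    C • (emp (a + n) * blockAvg p a n (energy p a n f))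

theorem Poincare.mono (hp : p ∈ Set.Icc (0 : ℝ) 1) {n : ℕ} {C C' : ℝ} (h : Poincare p n C)
    (hC : C ≤ C') : Poincare p n C' := fun a f => by
  refine (h a f).trans fun ω => ?_
  refine mul_le_mul_of_nonneg_right hC (mul_nonneg (emp_nonneg _ ω) ?_)
  exact (isAveraging_blockAvg hp a n).nonneg _ (energy_nonneg hp a n f) ω

theorem poincare_zero : Poincare p 0 1 := fun a f => by
  simp [blockAvg_zero, cvar, energy]

theorem poincare_one (hp : p ∈ Set.Icc (0 : ℝ) 1) : Poincare p 1 1 := fun a f => by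
  have h : siteAvg p a (siteEnergy p a f) = siteEnergy p a f := by
    rw [siteEnergy, (isAveraging_siteAvg hp a).pull_left _ (siteAvg_emp_of_ne p (by omega)),
      (isAveraging_siteAvg hp a).apply_cvar]
  rw [blockAvg_one, energy, Finset.sum_range_one, Nat.cast_zero, add_zero, h, one_smul,
    siteEnergy, ← mul_assoc, Nat.cast_one, emp_mul_self]

/-- On the event that `[a + l, a + l + d)` contains an empty site, the variance over `[a, a + l)`
is controlled by the Poincaré inequalities on intervals that end at an empty site. -/
theorem avg_vacant_mul_cvar_le (hp : p ∈ Set.Icc (0 : ℝ) 1) {N : ℕ} {C : ℝ} (hC : 0 ≤ C)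
    (hN : ∀ n ≤ N, Poincare p n C) (a : ℤ) (l d : ℕ) (hd : l + d ≤ N + 1) (f : Config → ℝ) :
    blockAvg p a (l + d) ((1 - full (a + l) d) * cvar (blockAvg p a l) f) ≤
      C • blockAvg p a (l + d) (energy p a (l + d) f) := by
  induction d with
  | zero =>
    rw [full_zero, sub_self, zero_mul, map_zero]
    intro ω
    exact mul_nonneg hC ((isAveraging_blockAvg hp a _).nonneg _ (energy_nonneg hp a _ f) ω)
  | succ d ih =>
    have ih := ih (by omega)
    set V := cvar (blockAvg p a l) f
    set B := blockAvg p a (l + d) with hB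
    have hBa : IsAveraging B := isAveraging_blockAvg hp _ _
    set y : ℤ := a + (l + d : ℕ) with hy
    have hy' : a + l + d = y := by rw [hy]; push_cast; ring
    have hBy : B (emp y) = emp y := blockAvg_emp p _ _ (Or.inr le_rfl)
    have hBy' : B (1 - emp y) = 1 - emp y := by rw [map_sub, hBa.one, hBy]
    have hS := isAveraging_siteAvg hp y
    have hcomm : blockAvg p a (l + (d + 1)) = siteAvg p y * B := by
      rw [← add_assoc, blockAvg_succ, (siteAvg_blockAvg_commute p y a (l + d)).eq]
    -- Iterated, this decomposes according to the position `y` of the rightmost empty site. That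
    -- event depends only on sites from `y` on, so the variables of `[a, y)` keep their product law
    -- and the inequality on `[a, y)` applies without loss.
    have hdec : (1 - full (a + l) (d + 1)) * V
        = emp y * V + (1 - emp y) * ((1 - full (a + l) d) * V) := by
      rw [full_succ, hy']; ring
    have hV : B V ≤ cvar B f := by
      have hc := blockAvg_commute p (a + l) a d l
      have : cvar B f = cvar (blockAvg p (a + l) d * blockAvg p a l) f := by
        rw [hB, blockAvg_add, hc.eq]
      rw [this, hB, blockAvg_add, ← hc.eq, Module.End.mul_apply,
        (isAveraging_blockAvg hp a l).apply_cvar]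
      exact (isAveraging_blockAvg hp (a + l) d).apply_cvar_le_cvar_mul f
    have hP := hN (l + d) (by omega) a f
    have hkey : B ((1 - full (a + l) (d + 1)) * V) ≤ C • B (energy p a (l + d) f) := by
      rw [hdec, map_add, hBa.pull_left _ hBy, hBa.pull_left _ hBy']
      intro ω
      have t1 := mul_le_mul_of_nonneg_left (hV ω) (emp_nonneg y ω)
      have t2 := hP ω
      have t3 := mul_le_mul_of_nonneg_left (ih ω) (sub_nonneg.2 (emp_le_one y ω))
      simp only [Pi.add_apply, Pi.mul_apply, Pi.smul_apply, Pi.sub_apply, smul_eq_mul,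
        Pi.one_apply] at t1 t2 t3 ⊢
      linarith
    rw [hcomm, Module.End.mul_apply, Module.End.mul_apply, ← map_smul, ← map_smul]
    refine hS.mono (hkey.trans ?_)
    rw [map_smul]
    intro ω
    exact mul_le_mul_of_nonneg_left
      (hBa.mono (energy_le_add hp a (l + d) 1 f) ω) hC

/-- The right block has length `N` and already ends at the boundary zero. The left block has length
`l` with `l + d ≤ N + 1`, so when the first `d` sites of the right block contain a zero, the left
block extends to an interval of length at most `N` ending at it. The left and right contributions
each cost at most `2 / r`, whence `4 / r`. -/
theorem Poincare.step (hp0 : 0 < p) (hp1 : p ≤ 1) {N d : ℕ} {C : ℝ} (hC : 0 ≤ C)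
    (hN : ∀ n ≤ N, Poincare p n C) (hd : 1 ≤ d) (hdN : d ≤ N) {n : ℕ} (hn : n ≤ 2 * N + 1 - d) :
    Poincare p n (4 / (1 - (1 - p) ^ d) * C) := by
  have hp : p ∈ Set.Icc (0 : ℝ) 1 := ⟨hp0.le, hp1⟩
  set r := 1 - (1 - p) ^ d with hr
  have hr0 : 0 < r := sub_pos.2 (pow_lt_one₀ (by linarith) (by linarith) (by omega))
  have hr1 : r ≤ 1 := sub_le_self _ (pow_nonneg (by linarith) _)
  have h2 : 2 ≤ 2 / r := by rw [le_div_iff₀ hr0]; linarith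
  have h24 : 4 / r = 2 / r + 2 / r := by rw [← add_div]; norm_num
  rcases le_or_gt n N with hnN | hnN
  · refine (hN n hnN).mono hp ?_
    exact le_mul_of_one_le_left hC (by linarith)
  obtain ⟨l, rfl⟩ : ∃ l, n = l + N := ⟨n - N, by omega⟩
  intro a f
  set E₁ := blockAvg p a l
  set E₂ := blockAvg p (a + l) N with hE₂
  have h₁ : IsAveraging E₁ := isAveraging_blockAvg hp _ _
  have h₂ : IsAveraging E₂ := isAveraging_blockAvg hp _ _
  have hc : Commute E₁ E₂ := blockAvg_commute _ _ _ _ _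
  have hE : blockAvg p a (l + N) = E₁ * E₂ := blockAvg_add _ _ _ _
  set y : ℤ := a + (l + N : ℕ) with hy
  have hy' : a + l + N = y := by rw [hy]; push_cast; ring
  have h₁y : E₁ (emp y) = emp y := blockAvg_emp p _ _ (Or.inr (by rw [hy]; push_cast; omega))
  have hfull : E₂ (full (a + l) d) = (1 - p) ^ d • 1 := by
    obtain ⟨k, rfl⟩ : ∃ k, N = d + k := ⟨N - d, by omega⟩
    rw [hE₂, blockAvg_add, Module.End.mul_apply,
      blockAvg_full_of_disjoint hp _ _ _ _ (Or.inr le_rfl), blockAvg_full hp]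
  have hA : (1 - full (a + l) d) * (1 - full (a + l) d) = 1 - full (a + l) d := by
    linear_combination full_mul_self (a + l) d
  have hA₁ : E₁ (1 - full (a + l) d) = 1 - full (a + l) d := by
    rw [map_sub, h₁.one, blockAvg_full_of_disjoint hp _ _ _ _ (Or.inl le_rfl)]
  have hA₂ : E₂ (1 - full (a + l) d) = r • 1 := by
    rw [map_sub, h₂.one, hfull, hr, sub_smul, one_smul]
  have main := h₁.cvar_apply_le_of_event h₂ hc hA hA₁ hr0 hA₂ f
  have hAV : E₂ ((1 - full (a + l) d) * cvar E₁ f) ≤ C • (E₁ * E₂) (energy p a (l + N) f) := by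
    -- `E₁` can be inserted freely, since it fixes both the event and `cvar E₁ f`; this makes the
    -- average run over the whole interval.
    have e1 : E₂ ((1 - full (a + l) d) * cvar E₁ f)
        = (E₁ * E₂) ((1 - full (a + l) d) * cvar E₁ f) := by
      rw [hc.eq, Module.End.mul_apply, h₁.pull_left _ hA₁, h₁.apply_cvar]
    obtain ⟨k, rfl⟩ : ∃ k, N = d + k := ⟨N - d, by omega⟩
    rw [e1, ← hE, ← add_assoc, blockAvg_add, (blockAvg_commute p _ _ _ _).eq,
      Module.End.mul_apply, Module.End.mul_apply, ← map_smul]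
    refine (isAveraging_blockAvg hp _ _).mono ?_
    refine (avg_vacant_mul_cvar_le hp hC hN a l d (by omega) f).trans fun ω => ?_
    exact mul_le_mul_of_nonneg_left
      ((isAveraging_blockAvg hp a _).mono (energy_le_add hp a (l + d) k f) ω) hC
  have hV₂ : emp y * E₁ (cvar E₂ f) ≤ C • (emp y * (E₁ * E₂) (energy p a (l + N) f)) := by
    have := h₁.mono (hN N le_rfl (a + l) f)
    rw [map_smul, hy', h₁.pull_left _ h₁y, h₁.pull_left _ h₁y] at this
    refine this.trans fun ω => mul_le_mul_of_nonneg_left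
      (mul_le_mul_of_nonneg_left ?_ (emp_nonneg y ω)) hC
    exact h₁.mono (h₂.mono (energy_le_add' hp a l N f)) ω
  rw [hE, IsAveraging.cvar_mul]
  intro ω
  have t1 := mul_le_mul_of_nonneg_left (main ω) (emp_nonneg y ω)
  have t2 := mul_le_mul_of_nonneg_left (hAV ω) (emp_nonneg y ω)
  have t3 := hV₂ ω
  simp only [Pi.add_apply, Pi.mul_apply, Pi.smul_apply, smul_eq_mul] at t1 t2 t3 ⊢
  have t4 := mul_le_mul_of_nonneg_left t2 (show 0 ≤ 2 / r by linarith)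
  have t5 := mul_le_mul_of_nonneg_left t3 (show 0 ≤ 2 / r by linarith)
  have t6 : 0 ≤ emp y ω * E₁ (cvar E₂ f) ω :=
    mul_nonneg (emp_nonneg y ω) (h₁.nonneg _ (h₂.cvar_nonneg f) ω)
  have t7 : 2 * (1 / r - 1) = 2 / r - 2 := by ring
  rw [t7] at t1
  rw [h24]
  linarith

end

/-! ### Chains of blocks and iteration over scales -/

section

variable {p : ℝ}

/-- Chains of blocks: the Poincaré inequality for an interval made of blocks that contain an empty
site with large probability. -/
theorem chain_le (hp : p ∈ Set.Icc (0 : ℝ) 1) {ℓ : ℕ} {C : ℝ} (hC : 0 ≤ C)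
    (hℓ : (1 - p) ^ ℓ ≤ 1 / 5) (hN : ∀ n ≤ 2 * ℓ, Poincare p n C) (m : ℕ) (a : ℤ)
    (f : Config → ℝ) :
    emp (a + (ℓ + m * ℓ : ℕ)) * (cvar (blockAvg p a (ℓ + m * ℓ)) f
        + cvar (blockAvg p a ℓ) (blockAvg p (a + ℓ) (m * ℓ) f)) ≤
      (5 * C) • (emp (a + (ℓ + m * ℓ : ℕ)) * blockAvg p a (ℓ + m * ℓ)
        ((2 : ℝ) • energy p a (ℓ + m * ℓ) f - energy p a ℓ f)) := by
  -- The extra variance of the first block and the subtracted energy of that block make the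
  -- induction close: the two-block inequality for the new block produces exactly the extra term of
  -- the next one.
  induction m generalizing a with
  | zero =>
    simp only [zero_mul, add_zero, blockAvg_zero, Module.End.one_apply]
    intro ω
    have t1 := hN ℓ (by omega) a f ω
    have t2 : 0 ≤ emp (a + ℓ) ω * blockAvg p a ℓ (energy p a ℓ f) ω :=
      mul_nonneg (emp_nonneg _ ω)
        ((isAveraging_blockAvg hp a ℓ).nonneg _ (energy_nonneg hp a ℓ f) ω)
    have t3 := mul_nonneg hC t2
    simp only [map_sub, map_smul, Pi.add_apply, Pi.mul_apply, Pi.sub_apply, Pi.smul_apply,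
      smul_eq_mul] at t1 t2 t3 ⊢
    linarith
  | succ m ih =>
    have hlen : ℓ + (m + 1) * ℓ = ℓ + (ℓ + m * ℓ) := by ring
    have hlen' : (m + 1) * ℓ = ℓ + m * ℓ := by ring
    rw [hlen, hlen']
    generalize m * ℓ = R at ih
    set r := 1 - (1 - p) ^ ℓ with hr
    -- The new first-block variance appears twice on the left: once from the law of total variance
    -- and once as the extra term. Twice `2 (1 / r - 1)` is then at most `1`, which the induction
    -- hypothesis absorbs, and twice `2 / r` is at most `5`.
    have hr4 : 4 / 5 ≤ r := by rw [hr]; linarith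
    have hr0 : 0 < r := by linarith
    have h2r : 2 / r ≤ 5 / 2 := by rw [div_le_iff₀ hr0]; linarith
    set E₀ := blockAvg p a ℓ with hE₀
    set E₁ := blockAvg p (a + ℓ) ℓ with hE₁
    set E₂ := blockAvg p (a + ℓ + ℓ) R with hE₂
    have h₀ : IsAveraging E₀ := isAveraging_blockAvg hp _ _
    have h₁ : IsAveraging E₁ := isAveraging_blockAvg hp _ _
    have h₂ : IsAveraging E₂ := isAveraging_blockAvg hp _ _
    have c₀₁ : Commute E₀ E₁ := blockAvg_commute _ _ _ _ _
    have c₀₂ : Commute E₀ E₂ := blockAvg_commute _ _ _ _ _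
    have c₁₂ : Commute E₁ E₂ := blockAvg_commute _ _ _ _ _
    have hE12 : blockAvg p (a + ℓ) (ℓ + R) = E₁ * E₂ := blockAvg_add _ _ _ _
    have hE : blockAvg p a (ℓ + (ℓ + R)) = E₀ * (E₁ * E₂) := by rw [blockAvg_add, hE12]
    set y : ℤ := a + (ℓ + (ℓ + R) : ℕ) with hy
    have hy' : a + ℓ + (ℓ + R : ℕ) = y := by rw [hy]; push_cast; ring
    have h₀y : E₀ (emp y) = emp y := blockAvg_emp p _ _ (Or.inr (by rw [hy]; push_cast; omega))
    have hA : (1 - full (a + ℓ) ℓ) * (1 - full (a + ℓ) ℓ) = 1 - full (a + ℓ) ℓ := by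
      linear_combination full_mul_self (a + ℓ) ℓ
    have hA₀ : E₀ (1 - full (a + ℓ) ℓ) = 1 - full (a + ℓ) ℓ := by
      rw [map_sub, h₀.one, blockAvg_full_of_disjoint hp _ _ _ _ (Or.inl le_rfl)]
    have hA₁ : E₁ (1 - full (a + ℓ) ℓ) = r • 1 := by
      rw [map_sub, h₁.one, hE₁, blockAvg_full hp, hr, sub_smul, one_smul]
    have hA₂ : E₂ (1 - full (a + ℓ) ℓ) = 1 - full (a + ℓ) ℓ := by
      rw [map_sub, h₂.one, blockAvg_full_of_disjoint hp _ _ _ _ (Or.inr le_rfl)]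
    have main := h₀.cvar_apply_le_of_event h₁ c₀₁ hA hA₀ hr0 hA₁ (E₂ f)
    have hAV : E₁ ((1 - full (a + ℓ) ℓ) * cvar E₀ (E₂ f))
        ≤ C • (E₀ * (E₁ * E₂)) (energy p a (ℓ + ℓ) f) := by
      have e1 : E₁ ((1 - full (a + ℓ) ℓ) * cvar E₀ (E₂ f))
          ≤ E₁ (E₂ ((1 - full (a + ℓ) ℓ) * cvar E₀ f)) := by
        rw [h₂.pull_left _ hA₂]
        refine h₁.mono fun ω => mul_le_mul_of_nonneg_left (h₀.cvar_apply_le h₂ c₀₂ f ω) ?_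
        exact sub_nonneg.2 (full_le_one _ _ ω)
      have e2 : E₁ (E₂ ((1 - full (a + ℓ) ℓ) * cvar E₀ f))
          = E₂ (blockAvg p a (ℓ + ℓ) ((1 - full (a + ℓ) ℓ) * cvar E₀ f)) := by
        rw [blockAvg_add, ← hE₀, ← hE₁, c₀₁.eq, Module.End.mul_apply, h₀.pull_left _ hA₀,
          h₀.apply_cvar]
        exact LinearMap.congr_fun c₁₂.eq _
      have e3 : E₀ * (E₁ * E₂) = E₂ * blockAvg p a (ℓ + ℓ) := by
        rw [blockAvg_add, ← mul_assoc, (c₀₂.mul_left c₁₂).eq]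
      rw [e3, Module.End.mul_apply, ← map_smul]
      refine (e1.trans_eq e2).trans (h₂.mono ?_)
      exact avg_vacant_mul_cvar_le hp hC hN a ℓ ℓ (by omega) f
    have ih' := h₀.mono (ih (a + ℓ))
    rw [hy', map_smul, h₀.pull_left _ h₀y, h₀.pull_left _ h₀y, hE12, ← Module.End.mul_apply,
      map_add] at ih'
    -- Only consecutive pairs of blocks overlap, so no site is charged more than twice.
    have henergy : (2 : ℝ) • energy p a (ℓ + (ℓ + R)) f - energy p a ℓ f
        = energy p a (ℓ + ℓ) f
          + ((2 : ℝ) • energy p (a + ℓ) (ℓ + R) f - energy p (a + ℓ) ℓ f) := by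
      rw [energy_add, energy_add p a ℓ ℓ]
      ext ω; simp; ring
    rw [hE, hE12, henergy, IsAveraging.cvar_mul, map_add (E₀ * (E₁ * E₂))]
    intro ω
    have t0 := emp_nonneg y ω
    have t1 := main ω
    have t2 := mul_le_mul_of_nonneg_left (hAV ω) (show 0 ≤ 2 / r by positivity)
    have t3 := ih' ω
    have hnn : 0 ≤ C * (E₀ * (E₁ * E₂)) (energy p a (ℓ + ℓ) f) ω := mul_nonneg hC
      ((h₀.nonneg _ (h₁.nonneg _ (h₂.nonneg _ (energy_nonneg hp _ _ f)))) ω)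
    have hnn' : 0 ≤ E₀ (cvar E₁ (E₂ f)) ω := h₀.nonneg _ (h₁.cvar_nonneg _) ω
    simp only [Pi.add_apply, Pi.mul_apply, Pi.smul_apply, smul_eq_mul] at t1 t2 t3 ⊢
    have t4 := mul_le_mul_of_nonneg_right h2r hnn
    have t5 : 2 * (1 / r - 1) * E₀ (cvar E₁ (E₂ f)) ω ≤ 1 / 2 * E₀ (cvar E₁ (E₂ f)) ω := by
      refine mul_le_mul_of_nonneg_right ?_ hnn'
      have : 2 * (1 / r - 1) = 2 / r - 2 := by ring
      linarith
    have t6 : cvar E₀ ((E₁ * E₂) f) ω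
        ≤ 5 / 2 * (C * (E₀ * (E₁ * E₂)) (energy p a (ℓ + ℓ) f) ω)
          + 1 / 2 * E₀ (cvar E₁ (E₂ f)) ω :=
      t1.trans (add_le_add (t2.trans t4) t5)
    have t7 := mul_le_mul_of_nonneg_left t6 t0
    linarith

theorem Poincare.chain (hp : p ∈ Set.Icc (0 : ℝ) 1) {ℓ : ℕ} {C : ℝ} (hC : 0 ≤ C)
    (hℓ : (1 - p) ^ ℓ ≤ 1 / 5) (hN : ∀ n ≤ 2 * ℓ, Poincare p n C) (m : ℕ) :
    Poincare p (ℓ + m * ℓ) (10 * C) := fun a f ω => by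
  have t1 := chain_le hp hC hℓ hN m a f ω
  have hE := isAveraging_blockAvg hp a (ℓ + m * ℓ)
  have t2 := mul_nonneg (emp_nonneg (a + (ℓ + m * ℓ : ℕ)) ω)
    ((isAveraging_blockAvg hp a ℓ).cvar_nonneg (blockAvg p (a + ℓ) (m * ℓ) f) ω)
  have t3 := mul_nonneg hC (mul_nonneg (emp_nonneg (a + (ℓ + m * ℓ : ℕ)) ω)
    (hE.nonneg _ (energy_nonneg hp a ℓ f) ω))
  simp only [map_sub, map_smul, Pi.add_apply, Pi.mul_apply, Pi.sub_apply, Pi.smul_apply,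
    smul_eq_mul] at t1 t2 t3 ⊢
  linarith

theorem one_sub_pow_le (hp : p ∈ Set.Icc (0 : ℝ) 1) (d : ℕ) : (1 - p) ^ d ≤ 1 / (1 + d * p) := by
  have hd : 0 < 1 + d * p := by have := hp.1; positivity
  rw [le_div_iff₀ hd]
  calc (1 - p) ^ d * (1 + d * p) ≤ (1 - p) ^ d * (1 + p) ^ d :=
        mul_le_mul_of_nonneg_left (one_add_mul_le_pow (by linarith [hp.1]) d)
          (pow_nonneg (by linarith [hp.2]) _)
    _ = ((1 - p) * (1 + p)) ^ d := (mul_pow _ _ _).symm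
    _ ≤ 1 := pow_le_one₀ (mul_nonneg (by linarith [hp.2]) (by linarith [hp.1]))
        (by nlinarith [hp.1])

theorem exists_poincare (hp0 : 0 < p) (hp1 : p ≤ 1) {η : ℝ} (hη0 : 0 < η) (hη1 : η < 1) (k : ℕ) :
    ∃ N : ℕ, (2 - η) ^ k ≤ N ∧ ∀ n ≤ N,
      Poincare p n (∏ i ∈ Finset.range k, (4 * (1 + 1 / (p * (η * (2 - η) ^ i))))) := by
  have hp : p ∈ Set.Icc (0 : ℝ) 1 := ⟨hp0.le, hp1⟩
  induction k with
  | zero =>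
    refine ⟨1, by simp, fun n hn => ?_⟩
    rw [Finset.range_zero, Finset.prod_empty]
    interval_cases n
    · exact poincare_zero
    · exact poincare_one hp
  | succ k ih =>
    obtain ⟨N, hN, hP⟩ := ih
    have hβ : 1 ≤ 2 - η := by linarith
    have hβk : 1 ≤ (2 - η) ^ k := one_le_pow₀ hβ
    have hN1 : (1 : ℝ) ≤ N := hβk.trans hN
    set d := ⌈η * N⌉₊ with hd
    have hd1 : 1 ≤ d := Nat.ceil_pos.2 (by positivity)
    have hdN : d ≤ N := Nat.ceil_le.2 (by nlinarith)
    have hdlt : (d : ℝ) < η * N + 1 := Nat.ceil_lt_add_one (by positivity)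
    have hdge : η * (2 - η) ^ k ≤ d := (mul_le_mul_of_nonneg_left hN hη0.le).trans (Nat.le_ceil _)
    set s := η * (2 - η) ^ k with hs
    have hs0 : 0 < s := by positivity
    set C := ∏ i ∈ Finset.range k, (4 * (1 + 1 / (p * (η * (2 - η) ^ i)))) with hC
    have hC0 : 0 ≤ C := Finset.prod_nonneg fun i _ => by
      have : 0 < 2 - η := by linarith
      positivity
    -- As `d < η N + 1`, the `+ 1` compensates the rounding and the scale is multiplied by at least
    -- `2 - η`.
    refine ⟨2 * N + 1 - d, ?_, fun n hn => ?_⟩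
    · rw [Nat.cast_sub (by omega), pow_succ]
      push_cast
      nlinarith
    · refine (Poincare.step hp0 hp1 hC0 hP hd1 hdN hn).mono hp ?_
      rw [Finset.prod_range_succ, ← hC, mul_comm C]
      refine mul_le_mul_of_nonneg_right ?_ hC0
      have h1 : (1 - p) ^ d ≤ 1 / (1 + p * s) := by
        refine (one_sub_pow_le hp d).trans (one_div_le_one_div_of_le (by positivity) ?_)
        nlinarith
      have h2 : p * s / (1 + p * s) ≤ 1 - (1 - p) ^ d := by
        have : p * s / (1 + p * s) = 1 - 1 / (1 + p * s) := by field_simp; ring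
        linarith
      calc 4 / (1 - (1 - p) ^ d) ≤ 4 / (p * s / (1 + p * s)) :=
            div_le_div_of_nonneg_left (by norm_num) (by positivity) h2
        _ = 4 * (1 + 1 / (p * s)) := by field_simp; ring

end

/-- The scales are iterated only until `(2 - η) ^ K` reaches `10 / p`, so `K` is about `L / b`. The
logarithms of the factors are bounded by the arithmetic progression `M + L - i b`, whose sum is `L²
/ (2 b)` up to terms linear in `L`; chaining then covers unbounded lengths. -/
theorem exists_uniform_poincare {η : ℝ} (hη0 : 0 < η) (hη1 : η < 1) :
    ∃ A B : ℝ, ∀ p : ℝ, 0 < p → p < 1 → ∃ C : ℝ, 0 < C ∧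
      C ≤ Real.exp (Real.log (1 / p) ^ 2 / (2 * Real.log (2 - η)) + A * Real.log (1 / p) + B) ∧
      ∃ ℓ : ℕ, 1 ≤ ℓ ∧ ∀ m : ℕ, Poincare p (ℓ + m * ℓ) C := by
  set β := 2 - η with hβ
  set b := Real.log β with hb
  have hβ1 : 1 < β := by linarith
  have hb0 : 0 < b := Real.log_pos hβ1
  -- Below the last scale `x = p η β ^ k` is at most `10`, so `4 (1 + x) ≤ 44`.
  set M := Real.log (44 / η) with hM
  have hM0 : 0 < M := Real.log_pos (by rw [lt_div_iff₀ hη0]; linarith)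
  set T := Real.log 10 with hT
  have hT0 : 0 < T := Real.log_pos (by norm_num)
  refine ⟨(M + b / 2) / b + (T + b) / (2 * b), (T + b) * (M + b / 2) / b + T, fun p hp0 hp1 => ?_⟩
  have hp : p ∈ Set.Icc (0 : ℝ) 1 := ⟨hp0.le, hp1.le⟩
  set L := Real.log (1 / p) with hL
  have hL0 : 0 < L := Real.log_pos (by rw [lt_div_iff₀ hp0]; linarith)
  have hLp : Real.exp L = 1 / p := Real.exp_log (by positivity)
  set K := ⌈(L + T) / b⌉₊ with hK
  have hK1 : L + T ≤ K * b := by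
    have := Nat.le_ceil ((L + T) / b)
    rwa [div_le_iff₀ hb0] at this
  have hK2 : K * b < L + T + b := by
    have := Nat.ceil_lt_add_one (show 0 ≤ (L + T) / b by positivity)
    rw [← sub_lt_iff_lt_add, lt_div_iff₀ hb0] at this
    linarith
  have hβpow : ∀ i : ℕ, β ^ i = Real.exp (i * b) := fun i => by
    rw [mul_comm, Real.exp_mul, hb, Real.exp_log (by linarith), Real.rpow_natCast]
  have h10p : 10 / p = Real.exp (L + T) := by
    rw [Real.exp_add, hLp, hT, Real.exp_log (by norm_num)]; ring
  obtain ⟨N, hN, hP⟩ := exists_poincare hp0 hp1.le hη0 hη1 K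
  rw [← hβ] at hP hN
  set C := ∏ i ∈ Finset.range K, (4 * (1 + 1 / (p * (η * β ^ i)))) with hC
  have hC0 : 0 < C := Finset.prod_pos fun i _ => by positivity
  have hprod : ∀ k ≤ K, ∏ i ∈ Finset.range k, (4 * (1 + 1 / (p * (η * β ^ i))))
      ≤ Real.exp (k * (M + L) - b * k * (k - 1) / 2) := by
    intro k
    induction k with
    | zero => simp
    | succ k ih =>
      intro hk
      rw [Finset.prod_range_succ]
      have hlt : (k : ℝ) * b < L + T := by
        have := Nat.lt_ceil.1 (show k < ⌈(L + T) / b⌉₊ by omega)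
        rwa [lt_div_iff₀ hb0] at this
      have hx : β ^ k ≤ 10 / p := by
        rw [hβpow, h10p]
        exact Real.exp_le_exp.2 hlt.le
      have hfac : 4 * (1 + 1 / (p * (η * β ^ k))) ≤ Real.exp (M + L - k * b) := by
        have e : Real.exp (M + L - k * b) = 44 / η * (1 / p) / β ^ k := by
          rw [Real.exp_sub, Real.exp_add, hLp, hM, Real.exp_log (by positivity), hβpow]
        have hpos : 0 < β ^ k := by positivity
        have hx' : β ^ k * p ≤ 10 := by rwa [le_div_iff₀ hp0] at hx
        rw [e]
        have e2 : 4 * (1 + 1 / (p * (η * β ^ k))) = (4 * (p * η * β ^ k + 1)) / (p * η * β ^ k) := by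
          field_simp
        have e3 : 44 / η * (1 / p) / β ^ k = 44 / (p * η * β ^ k) := by
          field_simp
        rw [e2, e3]
        refine div_le_div_of_nonneg_right ?_ (by positivity)
        nlinarith
      refine (mul_le_mul (ih (by omega)) hfac (by positivity) (by positivity)).trans_eq ?_
      rw [← Real.exp_add]
      congr 1
      push_cast
      ring
  have hCle := hprod K le_rfl
  rw [← hC] at hCle
  -- Then `1 + ℓ p ≥ 5`, which gives the `1 / 5` needed for chaining, while `2 ℓ ≤ 8 / p + 2 ≤ 10 /
  -- p ≤ N`.
  set ℓ := ⌈4 / p⌉₊ with hℓ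
  have hℓ1 : 4 / p ≤ ℓ := Nat.le_ceil _
  have hℓ2 : (ℓ : ℝ) < 4 / p + 1 := Nat.ceil_lt_add_one (by positivity)
  have hℓN : 2 * ℓ ≤ N := by
    have h1 : (2 * ℓ : ℝ) ≤ 10 / p := by
      have : 1 ≤ 1 / p := by rw [le_div_iff₀ hp0]; linarith
      have e1 : 4 / p = 4 * (1 / p) := by ring
      have e2 : 10 / p = 10 * (1 / p) := by ring
      rw [e2]
      rw [e1] at hℓ2
      linarith
    have h2 : 10 / p ≤ N := by
      refine le_trans ?_ hN
      rw [hβpow, h10p]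
      exact Real.exp_le_exp.2 hK1
    exact_mod_cast h1.trans h2
  have hsmall : (1 - p) ^ ℓ ≤ 1 / 5 := by
    refine (one_sub_pow_le hp ℓ).trans (one_div_le_one_div_of_le (by norm_num) ?_)
    rw [div_le_iff₀ hp0] at hℓ1
    linarith
  refine ⟨10 * C, by positivity, ?_, ℓ, Nat.ceil_pos.2 (by positivity), fun m =>
    Poincare.chain hp hC0.le hsmall (fun n hn => hP n (hn.trans hℓN)) m⟩
  have h10 : (10 : ℝ) = Real.exp T := by rw [hT, Real.exp_log (by norm_num)]
  rw [h10]
  refine (mul_le_mul_of_nonneg_left hCle (Real.exp_pos _).le).trans ?_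
  rw [← Real.exp_add]
  refine Real.exp_le_exp.2 ?_
  have hKle : (K : ℝ) ≤ (L + T + b) / b := by
    rw [le_div_iff₀ hb0]; exact hK2.le
  have h1 : K * (M + L) - b * K * (K - 1) / 2 = K * (M + L + b / 2 - K * b / 2) := by ring
  have h2 : K * (M + L + b / 2 - K * b / 2) ≤ K * (L / 2 + M + b / 2) :=
    mul_le_mul_of_nonneg_left (by linarith) (Nat.cast_nonneg K)
  have h3 : K * (L / 2 + M + b / 2) ≤ (L + T + b) / b * (L / 2 + M + b / 2) :=
    mul_le_mul_of_nonneg_right hKle (by positivity)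
  have h4 : (L + T + b) / b * (L / 2 + M + b / 2) + T
      = L ^ 2 / (2 * b) + ((M + b / 2) / b + (T + b) / (2 * b)) * L
        + ((T + b) * (M + b / 2) / b + T) := by
    field_simp
    ring
  linarith

/-! ### Invariance of the product measure under resampling; integrability -/

theorem measurable_update_const (x : ℤ) (s : Fin 2) :
    Measurable fun ω : Config => Function.update ω x s :=
  measurable_pi_lambda _ fun i => by
    rcases eq_or_ne i x with rfl | hi
    · simp
    · simpa [Function.update_of_ne hi] using measurable_pi_apply i

/-- Resampling one site preserves the measure: the identity is checked on cylinders, which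
characterise the infinite product. -/
theorem equilibrium_eq_add (q : unitInterval) (x : ℤ) :
    equilibrium q =
      unitInterval.toNNReal q • (equilibrium q).map (fun ω => Function.update ω x 0) +
      unitInterval.toNNReal (unitInterval.symm q) •
        (equilibrium q).map (fun ω => Function.update ω x 1) := by
  symm
  refine Measure.eq_infinitePi _ fun s t ht => ?_
  have hs : ∀ s : Finset ℤ, MeasurableSet ((s : Set ℤ).pi t) := fun s =>
    MeasurableSet.pi s.countable_toSet fun i _ => ht i
  rw [Measure.add_apply, Measure.smul_apply, Measure.smul_apply,
    Measure.map_apply (measurable_update_const x 0) (hs s),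
    Measure.map_apply (measurable_update_const x 1) (hs s)]
  by_cases hx : x ∈ s
  · have hpre : ∀ a : Fin 2, equilibrium q ((fun ω => Function.update ω x a) ⁻¹' (s : Set ℤ).pi t)
        = (t x).indicator 1 a * ∏ i ∈ s.erase x, siteMeasure q (t i) := by
      intro a
      by_cases ha : a ∈ t x
      · rw [Set.indicator_of_mem ha, Pi.one_apply, one_mul,
          ← Measure.infinitePi_pi _ (fun i _ => ht i)]
        congr 1
        ext ω
        simp only [Set.mem_preimage, Set.mem_pi, Finset.mem_coe, Finset.mem_erase]
        constructor
        · rintro h i ⟨hi, his⟩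
          have := h i his
          rwa [Function.update_of_ne hi] at this
        · intro h i his
          rcases eq_or_ne i x with rfl | hi
          · rwa [Function.update_self]
          · rw [Function.update_of_ne hi]; exact h i ⟨hi, his⟩
      · rw [Set.indicator_of_notMem ha, zero_mul]
        convert! measure_empty (μ := equilibrium q)
        rw [Set.eq_empty_iff_forall_notMem]
        intro ω h
        have := h x (Finset.mem_coe.2 hx)
        simp only [Function.update_self] at this
        exact ha this
    rw [hpre, hpre, ← Finset.mul_prod_erase s _ hx]
    have : siteMeasure q (t x) = unitInterval.toNNReal q • (t x).indicator (1 : Fin 2 → ℝ≥0∞) 0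
        + unitInterval.toNNReal (unitInterval.symm q) • (t x).indicator (1 : Fin 2 → ℝ≥0∞) 1 := by
      rw [siteMeasure, bernoulliMeasure_def, Measure.add_apply, Measure.smul_apply,
        Measure.smul_apply, Measure.dirac_apply' _ (ht x), Measure.dirac_apply' _ (ht x)]
    rw [this, add_mul, smul_mul_assoc, smul_mul_assoc]
  · have hpre : ∀ a : Fin 2, (fun ω => Function.update ω x a) ⁻¹' (s : Set ℤ).pi t
        = (s : Set ℤ).pi t := by
      intro a
      ext ω
      simp only [Set.mem_preimage, Set.mem_pi, Finset.mem_coe]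
      refine forall₂_congr fun i hi => ?_
      rw [Function.update_of_ne (by rintro rfl; exact hx hi)]
    rw [hpre, hpre, Measure.infinitePi_pi _ (fun i _ => ht i), ← add_smul]
    simp

theorem toNNReal_ne_zero {q : unitInterval} (h0 : 0 < q) : unitInterval.toNNReal q ≠ 0 := by
  intro h
  exact h0.ne' (Subtype.ext (by simpa using congrArg NNReal.toReal h))

theorem toNNReal_symm_ne_zero {q : unitInterval} (h1 : q < 1) :
    unitInterval.toNNReal (unitInterval.symm q) ≠ 0 := by
  intro h
  have h2 : (1 : ℝ) - q = 0 := by simpa using congrArg NNReal.toReal h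
  have h3 : (q : ℝ) < 1 := h1
  linarith

/-- Both values of a site have positive mass. This is what makes pointwise updates, and hence the
Dirichlet form, insensitive to the choice of an almost-everywhere representative. -/
theorem map_update_absolutelyContinuous {q : unitInterval} (h0 : 0 < q) (h1 : q < 1) (x : ℤ)
    (s : Fin 2) : (equilibrium q).map (fun ω => Function.update ω x s) ≪ equilibrium q := by
  have hq0 := toNNReal_ne_zero h0
  have hq1 := toNNReal_symm_ne_zero h1
  refine Measure.AbsolutelyContinuous.mk fun A _ hA => ?_
  rw [equilibrium_eq_add q x, Measure.add_apply, Measure.smul_apply, Measure.smul_apply,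
    add_eq_zero] at hA
  simp only [smul_eq_zero] at hA
  fin_cases s
  · exact hA.1.resolve_left hq0
  · exact hA.2.resolve_left hq1

theorem integrable_update {q : unitInterval} (h0 : 0 < q) (h1 : q < 1) {g : Config → ℝ}
    (hg : Integrable g (equilibrium q)) (x : ℤ) (s : Fin 2) :
    Integrable (fun ω => g (Function.update ω x s)) (equilibrium q) := by
  have hq0 := toNNReal_ne_zero h0
  have hq1 := toNNReal_symm_ne_zero h1
  rw [equilibrium_eq_add q x, integrable_add_measure] at hg
  fin_cases s
  · have := (integrable_smul_measure (c := (unitInterval.toNNReal q : ℝ≥0∞)) (by simpa using hq0)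
      ENNReal.coe_ne_top).1 hg.1
    exact this.comp_measurable (measurable_update_const x 0)
  · have := (integrable_smul_measure (c := (unitInterval.toNNReal (unitInterval.symm q) : ℝ≥0∞))
      (by simpa using hq1) ENNReal.coe_ne_top).1 hg.2
    exact this.comp_measurable (measurable_update_const x 1)

section

variable {q : unitInterval}

theorem integrable_siteAvg (h0 : 0 < q) (h1 : q < 1) {g : Config → ℝ}
    (hg : Integrable g (equilibrium q)) (x : ℤ) :
    Integrable (siteAvg q x g) (equilibrium q) :=
  ((integrable_update h0 h1 hg x 0).const_mul _).add ((integrable_update h0 h1 hg x 1).const_mul _)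

theorem integral_siteAvg (h0 : 0 < q) (h1 : q < 1) {g : Config → ℝ}
    (hg : Integrable g (equilibrium q)) (x : ℤ) :
    ∫ ω, siteAvg q x g ω ∂(equilibrium q) = ∫ ω, g ω ∂(equilibrium q) := by
  have hi := fun s => integrable_update h0 h1 hg x s
  have hm : ∀ s, AEStronglyMeasurable g
      ((equilibrium q).map fun ω => Function.update ω x s) := fun s =>
    hg.aestronglyMeasurable.mono_ac (map_update_absolutelyContinuous h0 h1 x s)
  have hint : ∀ s, Integrable g ((equilibrium q).map fun ω => Function.update ω x s) := fun s =>
    (integrable_map_measure (hm s) (measurable_update_const x s).aemeasurable).2 (hi s)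
  simp only [siteAvg_apply]
  rw [integral_add ((hi 0).const_mul _) ((hi 1).const_mul _), integral_const_mul,
    integral_const_mul]
  conv_rhs => rw [equilibrium_eq_add q x]
  rw [integral_add_measure ((hint 0).smul_measure_nnreal) ((hint 1).smul_measure_nnreal),
    integral_smul_nnreal_measure, integral_smul_nnreal_measure,
    integral_map (measurable_update_const x 0).aemeasurable (hm 0),
    integral_map (measurable_update_const x 1).aemeasurable (hm 1)]
  simp [NNReal.smul_def]

theorem integrable_blockAvg (h0 : 0 < q) (h1 : q < 1) {g : Config → ℝ}
    (hg : Integrable g (equilibrium q)) (a : ℤ) (n : ℕ) :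
    Integrable (blockAvg q a n g) (equilibrium q) := by
  induction n generalizing g with
  | zero => exact hg
  | succ n ih => exact ih (integrable_siteAvg h0 h1 hg _)

theorem integral_blockAvg (h0 : 0 < q) (h1 : q < 1) {g : Config → ℝ}
    (hg : Integrable g (equilibrium q)) (a : ℤ) (n : ℕ) :
    ∫ ω, blockAvg q a n g ω ∂(equilibrium q) = ∫ ω, g ω ∂(equilibrium q) := by
  induction n generalizing g with
  | zero => rfl
  | succ n ih =>
    rw [blockAvg_succ, Module.End.mul_apply, ih (integrable_siteAvg h0 h1 hg _),
      integral_siteAvg h0 h1 hg]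

end

theorem measurable_siteAvg {p : ℝ} {x : ℤ} {g : Config → ℝ} (hg : Measurable g) :
    Measurable (siteAvg p x g) :=
  ((hg.comp (measurable_update_const x 0)).const_mul _).add
    ((hg.comp (measurable_update_const x 1)).const_mul _)

theorem measurable_blockAvg {p : ℝ} {a : ℤ} (n : ℕ) {g : Config → ℝ} (hg : Measurable g) :
    Measurable (blockAvg p a n g) := by
  induction n generalizing g with
  | zero => exact hg
  | succ n ih => exact ih (measurable_siteAvg hg)

theorem measurable_emp (x : ℤ) : Measurable (emp x) :=
  Measurable.ite (measurable_pi_apply x (measurableSet_singleton 0)) measurable_const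
    measurable_const

theorem localVariance_eq (q : unitInterval) (x : ℤ) (f : Config → ℝ) (ω : Config) :
    localVariance q x f ω = ENNReal.ofReal (cvar (siteAvg q x) f ω) := by
  rw [localVariance, ← ofReal_variance (MemLp.of_discrete), variance_eq_sub MemLp.of_discrete]
  simp [cvar, siteAvg_apply, integral_bernoulliMeasure, pow_two]

theorem dirichletForm_eq (q : unitInterval) (f : Config → ℝ) :
    dirichletForm q f
      = ∑' x : ℤ, ∫⁻ ω, ENNReal.ofReal (siteEnergy q x f ω) ∂(equilibrium q) := by
  refine tsum_congr fun x => ?_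
  have hm : MeasurableSet (constraintSet x) :=
    measurable_pi_apply (x + 1) (measurableSet_singleton 0)
  rw [← lintegral_indicator hm]
  refine lintegral_congr fun ω => ?_
  simp only [siteEnergy, Set.indicator, constraintSet, Set.mem_ofPred_eq, Pi.mul_apply, emp,
    localVariance_eq]
  split_ifs <;> simp

theorem measurable_of_dependsOn {φ : Config → ℝ} {Λ : Finset ℤ} (h : DependsOn φ (Λ : Set ℤ)) :
    Measurable φ := by
  obtain ⟨g, rfl⟩ := dependsOn_iff_exists_comp.1 h
  exact (Measurable.of_discrete (f := g)).comp
    (measurable_pi_lambda _ fun i => measurable_pi_apply _)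

theorem exists_bound_of_dependsOn {φ : Config → ℝ} {Λ : Finset ℤ}
    (h : DependsOn φ (Λ : Set ℤ)) : ∃ M : ℝ, ∀ ω, ‖φ ω‖ ≤ M := by
  obtain ⟨g, rfl⟩ := dependsOn_iff_exists_comp.1 h
  obtain ⟨M, hM⟩ := (Set.finite_range fun ξ => ‖g ξ‖).bddAbove
  exact ⟨M, fun ω => hM ⟨_, rfl⟩⟩

theorem memLp_of_dependsOn (q : unitInterval) {φ : Config → ℝ} {Λ : Finset ℤ}
    (h : DependsOn φ (Λ : Set ℤ)) : MemLp φ 2 (equilibrium q) := by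
  obtain ⟨M, hM⟩ := exists_bound_of_dependsOn h
  exact MemLp.of_bound (measurable_of_dependsOn h).aestronglyMeasurable M
    (Eventually.of_forall hM)

theorem dependsOn_siteAvg {p : ℝ} {f : Config → ℝ} {S : Set ℤ} (h : DependsOn f S) (x : ℤ) :
    DependsOn (siteAvg p x f) (S \ {x}) := by
  intro ω ω' hω
  have : ∀ s, f (Function.update ω x s) = f (Function.update ω' x s) := fun s => h fun i hi => by
    rcases eq_or_ne i x with rfl | hix
    · simp
    · rw [Function.update_of_ne hix, Function.update_of_ne hix]
      exact hω i ⟨hi, hix⟩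
  rw [siteAvg_apply, siteAvg_apply, this, this]

theorem dependsOn_blockAvg {p : ℝ} {f : Config → ℝ} {S : Set ℤ} (h : DependsOn f S) (a : ℤ)
    (n : ℕ) : DependsOn (blockAvg p a n f) (S \ Set.Ico a (a + n)) := by
  induction n generalizing f S with
  | zero => simpa [blockAvg_zero] using h
  | succ n ih =>
    refine (ih (dependsOn_siteAvg h (a + n))).mono fun i hi => ?_
    simp only [Set.mem_sdiff, Set.mem_Ico, Set.mem_singleton_iff] at hi ⊢
    push_cast
    refine ⟨hi.1.1, fun h => ?_⟩
    have := hi.1.2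
    have := hi.2
    omega

theorem blockAvg_eq_const {q : unitInterval} (h0 : 0 < q) (h1 : q < 1) {φ : Config → ℝ}
    {Λ : Finset ℤ} (h : DependsOn φ (Λ : Set ℤ)) {a : ℤ} {n : ℕ}
    (hΛ : ∀ i ∈ Λ, a ≤ i ∧ i < a + n) (ω : Config) :
    blockAvg q a n φ ω = ∫ ω', φ ω' ∂(equilibrium q) := by
  have hd : DependsOn (blockAvg q a n φ) ∅ := by
    refine (dependsOn_blockAvg h a n).mono fun i hi => hi.2 (hΛ i hi.1)
  have hint := (memLp_of_dependsOn q h).integrable one_le_two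
  rw [← integral_blockAvg h0 h1 hint a n, integral_congr_ae
    (Eventually.of_forall fun ω' => hd.empty ω' ω)]
  simp

theorem integral_emp {q : unitInterval} (h0 : 0 < q) (h1 : q < 1) (x : ℤ) :
    ∫ ω, emp x ω ∂(equilibrium q) = q := by
  have hi : Integrable (emp x) (equilibrium q) := by
    refine Integrable.of_bound (measurable_emp x).aestronglyMeasurable 1 (Eventually.of_forall ?_)
    intro ω
    rw [Real.norm_of_nonneg (emp_nonneg x ω)]
    exact emp_le_one x ω
  rw [← integral_siteAvg h0 h1 hi x, siteAvg_emp_self]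
  simp

/-! ### From intervals to the whole line -/

section

variable {q : unitInterval} {F : Config → ℝ}

theorem integrable_mul_self (hF : MemLp F 2 (equilibrium q)) :
    Integrable (F * F) (equilibrium q) := by
  simpa [pow_two, Pi.mul_def] using hF.integrable_sq

theorem integrable_cvar_blockAvg (h0 : 0 < q) (h1 : q < 1) (hFm : Measurable F)
    (hF : MemLp F 2 (equilibrium q)) (a : ℤ) (n : ℕ) :
    Integrable (cvar (blockAvg q a n) F) (equilibrium q) := by
  have hE := isAveraging_blockAvg q.2 a n
  refine (integrable_blockAvg h0 h1 (integrable_mul_self hF) a n).mono ?_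
    (Eventually.of_forall fun ω => ?_)
  · exact ((measurable_blockAvg n (hFm.mul hFm)).sub
      ((measurable_blockAvg n hFm).mul (measurable_blockAvg n hFm))).aestronglyMeasurable
  · rw [Real.norm_of_nonneg (hE.cvar_nonneg F ω)]
    exact (IsAveraging.cvar_le _ F ω).trans (Real.le_norm_self _)

theorem integrable_emp_mul {g : Config → ℝ} (hg : Integrable g (equilibrium q)) (x : ℤ) :
    Integrable (emp x * g) (equilibrium q) := by
  refine hg.bdd_mul (c := 1) (measurable_emp x).aestronglyMeasurable (Eventually.of_forall ?_)
  intro ω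
  rw [Real.norm_of_nonneg (emp_nonneg x ω)]
  exact emp_le_one x ω

theorem integrable_siteEnergy (h0 : 0 < q) (h1 : q < 1) (hFm : Measurable F)
    (hF : MemLp F 2 (equilibrium q)) (x : ℤ) :
    Integrable (siteEnergy q x F) (equilibrium q) := by
  have := integrable_cvar_blockAvg h0 h1 hFm hF x 1
  rw [blockAvg_one] at this
  exact integrable_emp_mul this _

theorem integrable_energy (h0 : 0 < q) (h1 : q < 1) (hFm : Measurable F)
    (hF : MemLp F 2 (equilibrium q)) (a : ℤ) (n : ℕ) :
    Integrable (energy q a n F) (equilibrium q) := by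
  rw [energy]
  exact integrable_finsetSum' _ fun i _ => integrable_siteEnergy h0 h1 hFm hF _

theorem ofReal_integral_energy_le (h0 : 0 < q) (h1 : q < 1) (hFm : Measurable F)
    (hF : MemLp F 2 (equilibrium q)) (a : ℤ) (n : ℕ) :
    ENNReal.ofReal (∫ ω, energy q a n F ω ∂(equilibrium q)) ≤ dirichletForm q F := by
  have h : ∀ x, ENNReal.ofReal (∫ ω, siteEnergy q x F ω ∂(equilibrium q))
      = ∫⁻ ω, ENNReal.ofReal (siteEnergy q x F ω) ∂(equilibrium q) := fun x =>
    ofReal_integral_eq_lintegral_ofReal (integrable_siteEnergy h0 h1 hFm hF x)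
      (Eventually.of_forall (siteEnergy_nonneg q.2 x F))
  have hs : ∫ ω, energy q a n F ω ∂(equilibrium q)
      = ∑ i ∈ Finset.range n, ∫ ω, siteEnergy q (a + i) F ω ∂(equilibrium q) := by
    simp only [energy, Finset.sum_apply]
    exact integral_finsetSum _ fun i _ => integrable_siteEnergy h0 h1 hFm hF _
  rw [hs, ENNReal.ofReal_sum_of_nonneg fun i _ =>
    integral_nonneg (siteEnergy_nonneg q.2 _ F), dirichletForm_eq]
  simp only [h]
  have hinj : Set.InjOn (fun i : ℕ => a + (i : ℤ)) (Finset.range n) := fun i _ j _ hij => by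
    simpa using hij
  rw [← Finset.sum_image (f := fun x : ℤ =>
    ∫⁻ ω, ENNReal.ofReal (siteEnergy q x F ω) ∂(equilibrium q)) hinj]
  exact ENNReal.sum_le_tsum _

theorem variance_le_of_integral_sub_sq_le {ε : ℝ} {φ : Config → ℝ} (hF : MemLp F 2 (equilibrium q))
    (hφ : MemLp φ 2 (equilibrium q))
    (hε : ∫ ω, ((φ - F) * (φ - F)) ω ∂(equilibrium q) ≤ ε) :
    variance F (equilibrium q) ≤ 2 * variance φ (equilibrium q) + 2 * ε := by
  have hd : MemLp (φ - F) 2 (equilibrium q) := hφ.sub hF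
  have h1 : variance (φ - F) (equilibrium q) ≤ ε := by
    refine (variance_le_expectation_sq hd.aestronglyMeasurable).trans (le_trans (le_of_eq ?_) hε)
    simp [pow_two]
  have h2 : variance F (equilibrium q) = variance (φ - (φ - F)) (equilibrium q) := by
    rw [sub_sub_cancel]
  have h3 := variance_sub hφ hd
  have h4 := variance_add hφ hd
  have h5 := variance_nonneg (φ + (φ - F)) (equilibrium q)
  rw [h2, h3]
  linarith

/-- Passage from the interval Poincaré inequalities to the process on `ℤ`. -/
theorem evariance_le_of_poincare (h0 : 0 < q) (h1 : q < 1) {C : ℝ} (hC : 0 < C) {ℓ : ℕ}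
    (hℓ : 1 ≤ ℓ) (hP : ∀ m : ℕ, Poincare q (ℓ + m * ℓ) C) (hFm : Measurable F)
    (hF : MemLp F 2 (equilibrium q))
    (happ : ∀ ε > 0, ∃ (φ : Config → ℝ) (Λ : Finset ℤ), DependsOn φ (Λ : Set ℤ) ∧
      ∫ ω, ((φ - F) * (φ - F)) ω ∂(equilibrium q) ≤ ε) :
    ENNReal.ofReal (q / (4 * C)) * evariance F (equilibrium q) ≤ dirichletForm q F := by
  have hq0 : (0 : ℝ) < q := h0
  have hq1 : (q : ℝ) < 1 := h1
  rcases eq_or_ne (dirichletForm q F) ⊤ with hD | hD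
  · rw [hD]; exact le_top
  rw [← ofReal_variance hF, ← ENNReal.ofReal_mul (by positivity), ← ENNReal.ofReal_toReal hD]
  refine ENNReal.ofReal_le_ofReal ?_
  set D := (dirichletForm q F).toReal
  -- The `6` is `4 + 2`: twice the `2 ε` in `s2`, plus `2 q ε ≤ 2 ε` from `s3`.
  suffices h : ∀ ε > 0, q * variance F (equilibrium q) ≤ 4 * C * D + ε * 6 by
    rw [div_mul_eq_mul_div, div_le_iff₀ (by positivity)]
    refine le_of_forall_pos_le_add fun ε hε => ?_
    have := h (ε / 6) (by positivity)
    linarith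
  intro ε hε
  obtain ⟨φ, Λ, hφ, hφε⟩ := happ ε hε
  have hφm := measurable_of_dependsOn hφ
  have hφL := memLp_of_dependsOn q hφ
  obtain ⟨k, hk⟩ : ∃ k : ℕ, ∀ i ∈ Λ, -(k : ℤ) ≤ i ∧ i < k := by
    refine ⟨∑ i ∈ Λ, i.natAbs + 1, fun i hi => ?_⟩
    have := Finset.single_le_sum (f := fun i : ℤ => i.natAbs) (fun _ _ => Nat.zero_le _) hi
    push_cast
    zify at this
    constructor
    · have := neg_abs_le i; omega
    · have := le_abs_self i; omega
  set a : ℤ := -(k : ℤ)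
  -- A length of the admissible form `ℓ + m ℓ`, at least `2 k` because `ℓ ≥ 1`.
  set n := ℓ + 2 * k * ℓ with hn
  have hΛ : ∀ i ∈ Λ, a ≤ i ∧ i < a + n := fun i hi => by
    refine ⟨(hk i hi).1, (hk i hi).2.trans_le ?_⟩
    have : 2 * k ≤ n := by nlinarith
    zify at this
    simp only [a]
    omega
  set B := blockAvg (q : ℝ) a n with hB
  have hBa : IsAveraging B := isAveraging_blockAvg q.2 a n
  have hφφ : DependsOn (φ * φ) (Λ : Set ℤ) := fun ω ω' h => by simp [hφ h]
  -- The block contains the support of `φ`, so its conditional variance is constant and integrates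
  -- against `emp b` to exactly `q` times the variance. This fails for `F` itself, hence the detour
  -- through `φ`.
  have hconst : cvar B φ = fun _ => variance φ (equilibrium q) := by
    ext ω
    rw [variance_eq_sub hφL]
    simp only [cvar, Pi.sub_apply, Pi.mul_apply, hB, blockAvg_eq_const h0 h1 hφ hΛ,
      blockAvg_eq_const h0 h1 hφφ hΛ, Pi.pow_apply, pow_two]
  have i1 : Integrable (energy q a n F) (equilibrium q) := integrable_energy h0 h1 hFm hF a n
  have i2 : Integrable (B (energy q a n F)) (equilibrium q) := integrable_blockAvg h0 h1 i1 a n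
  have i3 : Integrable (cvar B F) (equilibrium q) := integrable_cvar_blockAvg h0 h1 hFm hF a n
  have i4 : Integrable (B ((φ - F) * (φ - F))) (equilibrium q) :=
    integrable_blockAvg h0 h1 (integrable_mul_self (hφL.sub hF)) a n
  set b : ℤ := a + n
  have s1 : ∫ ω, (emp b * cvar B F) ω ∂(equilibrium q) ≤ C * D := by
    have e1 : emp b * cvar B F ≤ C • B (energy q a n F) := by
      refine (hP (2 * k) a F).trans fun ω => mul_le_mul_of_nonneg_left ?_ hC.le
      exact mul_le_of_le_one_left (hBa.nonneg _ (energy_nonneg q.2 a n F) ω) (emp_le_one b ω)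
    refine (integral_mono (integrable_emp_mul i3 b) (i2.smul C) e1).trans ?_
    simp only [Pi.smul_apply, smul_eq_mul]
    rw [integral_const_mul, hB, integral_blockAvg h0 h1 i1]
    refine mul_le_mul_of_nonneg_left ?_ hC.le
    exact (ENNReal.ofReal_le_iff_le_toReal hD).1 (ofReal_integral_energy_le h0 h1 hFm hF a n)
  have s2 : q * variance φ (equilibrium q) ≤ 2 * (C * D) + 2 * ε := by
    have e1 : emp b * cvar B φ
        ≤ (2 : ℝ) • (emp b * cvar B F) + (2 : ℝ) • B ((φ - F) * (φ - F)) := by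
      have e2 := hBa.cvar_add_le F (φ - F)
      rw [add_sub_cancel] at e2
      intro ω
      have t1 := mul_le_mul_of_nonneg_left (e2 ω) (emp_nonneg b ω)
      have t2 := IsAveraging.cvar_le B (φ - F) ω
      have t3 := mul_le_of_le_one_left (hBa.cvar_nonneg (φ - F) ω) (emp_le_one b ω)
      simp only [Pi.add_apply, Pi.mul_apply, Pi.smul_apply, smul_eq_mul]
        at t1 t2 t3 ⊢
      linarith
    have i5 := integrable_cvar_blockAvg h0 h1 hφm hφL a n
    have e3 := integral_mono (integrable_emp_mul i5 b)
      (((integrable_emp_mul i3 b).smul (2 : ℝ)).add (i4.smul (2 : ℝ))) e1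
    rw [integral_add' ((integrable_emp_mul i3 b).smul (2 : ℝ)) (i4.smul (2 : ℝ))] at e3
    simp only [Pi.smul_apply, smul_eq_mul] at e3
    rw [integral_const_mul, integral_const_mul, ← hB, hconst, hB,
      integral_blockAvg h0 h1 (integrable_mul_self (hφL.sub hF))] at e3
    simp only [Pi.mul_apply] at e3 s1 hφε
    rw [integral_mul_const, integral_emp h0 h1] at e3
    linarith
  have s3 := variance_le_of_integral_sub_sq_le hF hφL hφε
  have s4 := mul_le_mul_of_nonneg_left s3 hq0.le
  nlinarith

end

theorem exists_approx_of_mem_generatorDomain {q : unitInterval} {F : Lp ℝ 2 (equilibrium q)}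
    (hF : F ∈ generatorDomain q) {ε : ℝ} (hε : 0 < ε) :
    ∃ (φ : Config → ℝ) (Λ : Finset ℤ), DependsOn φ (Λ : Set ℤ) ∧
      ∫ ω, ((φ - F) * (φ - F)) ω ∂(equilibrium q) ≤ ε := by
  obtain ⟨g, hg⟩ := hF
  obtain ⟨b, ⟨φ, ⟨Λ, hΛ⟩, hφ, -⟩, hb⟩ := Metric.mem_closure_iff.1 hg (Real.sqrt ε)
    (Real.sqrt_pos.2 hε)
  refine ⟨φ, Λ, hΛ, ?_⟩
  have h1 : ‖b.1 - F‖ < Real.sqrt ε := by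
    rw [← dist_eq_norm, dist_comm]
    exact lt_of_le_of_lt (le_max_left _ _) hb
  have h2 : ‖b.1 - F‖ ^ 2 ≤ ε := by
    rw [← Real.sq_sqrt hε.le]
    exact pow_le_pow_left₀ (norm_nonneg _) h1.le 2
  refine le_trans (le_of_eq ?_) h2
  rw [← real_inner_self_eq_norm_sq, MeasureTheory.L2.inner_def]
  refine integral_congr_ae ?_
  filter_upwards [hφ, Lp.coeFn_sub b.1 F] with ω e1 e2
  rw [e2, Pi.sub_apply, e1]
  simp [pow_two]

/-! ### Combinatorics of the bottleneck -/

/-- Sets of `m` positive integers obtained from `∅` by successive insertions, where the `j`-th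
inserted point lies within distance `2 ^ (n - j)` above a point already present (or above `0`). -/
def goodSets (n : ℕ) : ℕ → Finset (Finset ℕ)
  | 0 => {∅}
  | m + 1 => (goodSets n m).biUnion fun S =>
      (((insert 0 S) ×ˢ Finset.Icc 1 (2 ^ (n - (m + 1)))).filter fun yg => yg.1 + yg.2 ∉ S).image
        fun yg => insert (yg.1 + yg.2) S

theorem mem_goodSets_succ {n m : ℕ} {T : Finset ℕ} : T ∈ goodSets n (m + 1) ↔
    ∃ S ∈ goodSets n m, ∃ x ∉ S, (∃ y ∈ insert 0 S, y < x ∧ x ≤ y + 2 ^ (n - (m + 1))) ∧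
      T = insert x S := by
  simp only [goodSets, Finset.mem_biUnion, Finset.mem_image, Finset.mem_filter,
    Finset.mem_product, Finset.mem_Icc, Prod.exists]
  constructor
  · rintro ⟨S, hS, y, g, ⟨⟨hy, hg⟩, hn⟩, rfl⟩
    exact ⟨S, hS, y + g, hn, ⟨y, hy, by omega, by omega⟩, rfl⟩
  · rintro ⟨S, hS, x, hx, ⟨y, hy, h1, h2⟩, rfl⟩
    have e : y + (x - y) = x := by omega
    exact ⟨S, hS, y, x - y, ⟨⟨hy, by omega, by omega⟩, by rwa [e]⟩, by rw [e]⟩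

theorem card_of_mem_goodSets {n m : ℕ} {T : Finset ℕ} (h : T ∈ goodSets n m) : T.card = m := by
  induction m generalizing T with
  | zero => simp only [goodSets, Finset.mem_singleton] at h; simp [h]
  | succ m ih =>
    obtain ⟨S, hS, x, hx, -, rfl⟩ := mem_goodSets_succ.1 h
    rw [Finset.card_insert_of_notMem hx, ih hS]

/-- The jumps sum to at most `2^(n-1) + ... + 2^(n-m) = 2^n - 2^(n-m)`; in particular a good set
never contains `2^n`. -/
theorem add_le_of_mem_goodSets {n m : ℕ} (hm : m ≤ n) {T : Finset ℕ} (h : T ∈ goodSets n m)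
    {x : ℕ} (hx : x ∈ T) : x + 2 ^ (n - m) ≤ 2 ^ n := by
  induction m generalizing T x with
  | zero => simp only [goodSets, Finset.mem_singleton] at h; simp [h] at hx
  | succ m ih =>
    obtain ⟨S, hS, z, hz, ⟨y, hy, hyz, hzy⟩, rfl⟩ := mem_goodSets_succ.1 h
    have e : 2 ^ (n - m) = 2 * 2 ^ (n - (m + 1)) := by
      rw [← pow_succ']; congr 1; omega
    have hle : 2 ^ (n - m) ≤ 2 ^ n := Nat.pow_le_pow_right (by norm_num) (by omega)
    have hy' : y + 2 ^ (n - m) ≤ 2 ^ n := by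
      rcases Finset.mem_insert.1 hy with rfl | hy
      · omega
      · exact ih (by omega) hS hy
    rcases Finset.mem_insert.1 hx with rfl | hx
    · omega
    · have := ih (by omega) hS hx
      omega

theorem card_goodSets_le (n m : ℕ) :
    (goodSets n m).card ≤ ∏ i ∈ Finset.range m, ((i + 1) * 2 ^ (n - (i + 1))) := by
  induction m with
  | zero => simp [goodSets]
  | succ m ih =>
    rw [goodSets, Finset.prod_range_succ]
    refine Finset.card_biUnion_le.trans ?_
    refine (Finset.sum_le_card_nsmul _ _ ((m + 1) * 2 ^ (n - (m + 1))) fun S hS => ?_).trans ?_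
    · refine Finset.card_image_le.trans ((Finset.card_filter_le _ _).trans ?_)
      rw [Finset.card_product, Nat.card_Icc, Nat.add_sub_cancel]
      refine Nat.mul_le_mul_right _ ((Finset.card_insert_le _ _).trans ?_)
      rw [card_of_mem_goodSets hS]
    · rw [smul_eq_mul]
      exact Nat.mul_le_mul_right _ ih

/-- A point of a good set that can be removed leaves a good set. -/
theorem erase_mem_goodSets {n m : ℕ} (hm : m + 1 ≤ n) {T : Finset ℕ} (h : T ∈ goodSets n (m + 1))
    {z : ℕ} (hz : z ∈ T) {y : ℕ} (hy : y ∈ insert 0 T) (hyz : y < z)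
    (hzy : z ≤ y + 2 ^ (n - (m + 1))) : T.erase z ∈ goodSets n m := by
  induction m generalizing T z y with
  | zero =>
    have := card_of_mem_goodSets h
    obtain ⟨x, rfl⟩ := Finset.card_eq_one.1 this
    rw [Finset.mem_singleton.1 hz]
    simp [goodSets]
  | succ m ih =>
    obtain ⟨S, hS, x, hx, ⟨y', hy', h1, h2⟩, rfl⟩ := mem_goodSets_succ.1 h
    rcases eq_or_ne z x with rfl | hzx
    · rwa [Finset.erase_insert hx]
    have hzS : z ∈ S := (Finset.mem_insert.1 hz).resolve_left hzx
    -- Without `z` every remaining index may drop by one, which doubles the allowed distance, so two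
    -- old jumps fit into one. If `z` hangs from `x`, it can hang from the predecessor `y'` of `x`
    -- instead.
    have e : 2 ^ (n - (m + 1)) = 2 * 2 ^ (n - (m + 1 + 1)) := by
      rw [← pow_succ']; congr 1; omega
    have hS' : S.erase z ∈ goodSets n m := by
      rcases eq_or_ne y x with rfl | hyx
      · exact ih (by omega) hS hzS hy' (h1.trans hyz) (by omega)
      · refine ih (by omega) hS hzS (y := y) ?_ hyz (by omega)
        simp only [Finset.mem_insert] at hy ⊢
        tauto
    rw [Finset.erase_insert_of_ne hzx.symm]
    refine mem_goodSets_succ.2 ⟨_, hS', x, fun h => hx (Finset.mem_of_mem_erase h), ?_, rfl⟩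
    -- If `x` hung from the erased point, it is hung from that point's own predecessor `y`.
    rcases eq_or_ne y' z with rfl | hyz'
    · refine ⟨y, ?_, hyz.trans h1, by omega⟩
      simp only [Finset.mem_insert, Finset.mem_erase] at hy ⊢
      rcases hy with hy | hy | hy
      · exact Or.inl hy
      · omega
      · exact Or.inr ⟨hyz.ne, hy⟩
    · refine ⟨y', ?_, h1, by omega⟩
      simp only [Finset.mem_insert, Finset.mem_erase] at hy' ⊢
      tauto

/-- The set of empty sites in `[-N, -1]`, with the orientation reversed. -/
def emptySet (N : ℕ) (ω : Config) : Finset ℕ :=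
  (Finset.Icc 1 N).filter fun x => ω (-(x : ℤ)) = 0

theorem mem_emptySet {N : ℕ} {ω : Config} {x : ℕ} :
    x ∈ emptySet N ω ↔ (1 ≤ x ∧ x ≤ N) ∧ ω (-(x : ℤ)) = 0 := by
  simp [emptySet]

/-- The event that the empty sites of `[-N, -1]` form a good set. -/
def bottleneckSet (n N : ℕ) : Set Config := {ω | ∃ m ≤ n, emptySet N ω ∈ goodSets n m}

/-- A legal flip at `x` has the predecessor `x - 1` present, where `0` always counts as present, so
the relevant distance is `1`, allowed at every scale. Removing `x` therefore stays in the event, and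
inserting it leaves the event only if all `n` insertions are used up. -/
theorem mem_goodSets_of_not_iff {n N : ℕ} {ω : Config} {x : ℕ} (hx1 : 1 ≤ x) (hxN : x ≤ N)
    (hω : ω (-(x : ℤ) + 1) = 0)
    (h : ¬ (Function.update ω (-(x : ℤ)) 0 ∈ bottleneckSet n N ↔
      Function.update ω (-(x : ℤ)) 1 ∈ bottleneckSet n N)) :
    emptySet N (Function.update ω (-(x : ℤ)) 1) ∈ goodSets n n := by
  set S := emptySet N (Function.update ω (-(x : ℤ)) 1) with hS
  have hxS : x ∉ S := by simp [hS, mem_emptySet]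
  have hT : emptySet N (Function.update ω (-(x : ℤ)) 0) = insert x S := by
    ext y
    rcases eq_or_ne y x with rfl | hyx
    · simp [mem_emptySet, hx1, hxN]
    · have : (-(y : ℤ)) ≠ -(x : ℤ) := by omega
      simp [hS, mem_emptySet, hyx, this]
  have hpred : x - 1 ∈ insert 0 S := by
    rcases Nat.eq_or_lt_of_le hx1 with rfl | hx2
    · simp
    · refine Finset.mem_insert_of_mem (mem_emptySet.2 ⟨by omega, ?_⟩)
      have e : (-((x - 1 : ℕ) : ℤ)) = -(x : ℤ) + 1 := by omega
      rw [e, Function.update_of_ne (by omega), hω]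
  have hone : ∀ k, 1 ≤ 2 ^ k := fun k => Nat.one_le_two_pow
  simp only [bottleneckSet, Set.mem_ofPred_eq, hT, ← hS] at h
  have hTS : (∃ m ≤ n, insert x S ∈ goodSets n m) → ∃ m ≤ n, S ∈ goodSets n m := by
    rintro ⟨m, hm, h⟩
    cases m with
    | zero => simp [goodSets] at h
    | succ m =>
      have := erase_mem_goodSets hm h (Finset.mem_insert_self x S) (y := x - 1)
        (by simp only [Finset.mem_insert] at hpred ⊢; tauto) (by omega)
        (by have := hone (n - (m + 1)); omega)
      rw [Finset.erase_insert hxS] at this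
      exact ⟨m, by omega, this⟩
  have hTn : ¬ ∃ m ≤ n, insert x S ∈ goodSets n m := fun hP => h ⟨hTS, fun _ => hP⟩
  obtain ⟨m, hm, hSm⟩ : ∃ m ≤ n, S ∈ goodSets n m :=
    by_contra fun hQ => h (iff_of_false hTn hQ)
  rcases hm.eq_or_lt with rfl | hlt
  · exact hSm
  · refine absurd ⟨m + 1, hlt, ?_⟩ hTn
    refine mem_goodSets_succ.2 ⟨S, hSm, x, hxS, ⟨x - 1, hpred, by omega, ?_⟩, rfl⟩
    have := hone (n - (m + 1)); omega

/-! ### Energy and variance of the bottleneck test function -/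

open Classical in
/-- The test function: indicator of the bottleneck event. -/
noncomputable def testFunction (n N : ℕ) (ω : Config) : ℝ := if ω ∈ bottleneckSet n N then 1 else 0

theorem dependsOn_testFunction (n N : ℕ) :
    DependsOn (testFunction n N)
      (((Finset.Icc 1 N).image fun x : ℕ => -(x : ℤ) : Finset ℤ) : Set ℤ) := by
  intro ω ω' h
  have : emptySet N ω = emptySet N ω' := by
    refine Finset.filter_congr fun x hx => ?_
    rw [h (-(x : ℤ)) (Finset.mem_coe.2 (Finset.mem_image_of_mem _ hx))]
  have hiff : ω ∈ bottleneckSet n N ↔ ω' ∈ bottleneckSet n N := by simp [bottleneckSet, this]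
  unfold testFunction
  classical exact if_congr hiff rfl rfl

theorem siteEnergy_testFunction_of_notMem {p : ℝ} (n N : ℕ) {x : ℤ}
    (hx : x ∉ (Finset.Icc 1 N).image fun x : ℕ => -(x : ℤ)) :
    siteEnergy p x (testFunction n N) = 0 := by
  have h : ∀ ω s, testFunction n N (Function.update ω x s) = testFunction n N ω := fun ω s =>
    dependsOn_testFunction n N fun i hi => by
      rw [Function.update_of_ne]
      rintro rfl
      exact hx (Finset.mem_coe.1 hi)
  ext ω
  simp only [siteEnergy, cvar, siteAvg_apply, Pi.mul_apply, Pi.sub_apply, h, Pi.zero_apply]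
  ring

/-- A jump of the indicator forces the `n` sites of some extremal good set to be empty, and these
avoid `x`; a union bound follows. The prefactor `p` comes from the variance `p (1 - p)` of the
refreshed site and later cancels the `q` in the variance bound. -/
theorem siteEnergy_testFunction_le {p : ℝ} (hp : p ∈ Set.Icc (0 : ℝ) 1) (n N : ℕ) {x : ℕ}
    (hx1 : 1 ≤ x) (hxN : x ≤ N) (ω : Config) :
    siteEnergy p (-(x : ℤ)) (testFunction n N) ω ≤
      p * ∑ S ∈ goodSets n n,
        {ω : Config | ∀ y ∈ S, ω (-(y : ℤ)) = 0}.indicator (fun _ => (1 : ℝ)) ω := by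
  have hsum : 0 ≤ ∑ S ∈ goodSets n n,
      {ω : Config | ∀ y ∈ S, ω (-(y : ℤ)) = 0}.indicator (fun _ => (1 : ℝ)) ω :=
    Finset.sum_nonneg fun S _ => Set.indicator_nonneg (fun _ _ => zero_le_one) _
  have hcv : cvar (siteAvg p (-(x : ℤ))) (testFunction n N) ω = p * (1 - p) *
      (testFunction n N (Function.update ω (-(x : ℤ)) 0)
        - testFunction n N (Function.update ω (-(x : ℤ)) 1)) ^ 2 := by
    simp only [cvar, siteAvg_apply, Pi.mul_apply, Pi.sub_apply]; ring
  have hrhs := mul_nonneg hp.1 hsum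
  simp only [siteEnergy, Pi.mul_apply, hcv]
  by_cases hω : ω (-(x : ℤ) + 1) = 0
  swap
  · simp only [emp, hω, if_false, zero_mul]; exact hrhs
  by_cases h : Function.update ω (-(x : ℤ)) 0 ∈ bottleneckSet n N ↔
      Function.update ω (-(x : ℤ)) 1 ∈ bottleneckSet n N
  · have : testFunction n N (Function.update ω (-(x : ℤ)) 0)
        = testFunction n N (Function.update ω (-(x : ℤ)) 1) := by
      unfold testFunction
      classical exact if_congr h rfl rfl
    rw [this, sub_self]
    simpa using hrhs
  · have hS := mem_goodSets_of_not_iff hx1 hxN hω h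
    set S := emptySet N (Function.update ω (-(x : ℤ)) 1) with hSdef
    have hmem : ω ∈ {ω : Config | ∀ y ∈ S, ω (-(y : ℤ)) = 0} := by
      intro y hy
      have := (mem_emptySet.1 hy).2
      rcases eq_or_ne (-(y : ℤ)) (-(x : ℤ)) with e | e
      · rw [e, Function.update_self] at this; exact absurd this (by decide)
      · rwa [Function.update_of_ne e] at this
    have hone : 1 ≤ ∑ S ∈ goodSets n n,
        {ω : Config | ∀ y ∈ S, ω (-(y : ℤ)) = 0}.indicator (fun _ => (1 : ℝ)) ω := by
      refine le_trans (le_of_eq ?_) (Finset.single_le_sum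
        (f := fun S : Finset ℕ =>
          {ω : Config | ∀ y ∈ S, ω (-(y : ℤ)) = 0}.indicator (fun _ => (1 : ℝ)) ω)
        (fun S _ => Set.indicator_nonneg (fun _ _ => zero_le_one) _) hS)
      rw [Set.indicator_of_mem hmem]
    have hsq : (testFunction n N (Function.update ω (-(x : ℤ)) 0)
        - testFunction n N (Function.update ω (-(x : ℤ)) 1)) ^ 2 ≤ 1 := by
      simp only [testFunction]; split_ifs <;> norm_num
    have he : emp (-(x : ℤ) + 1) ω = 1 := by simp [emp, hω]
    rw [he, one_mul, mul_assoc]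
    refine mul_le_mul_of_nonneg_left (le_trans ?_ hone) hp.1
    exact mul_le_one₀ (by linarith [hp.1]) (sq_nonneg _) hsq

theorem equilibrium_forall_empty (q : unitInterval) (S : Finset ℕ) :
    equilibrium q {ω : Config | ∀ y ∈ S, ω (-(y : ℤ)) = 0} = ENNReal.ofReal ((q : ℝ) ^ S.card) := by
  have e : {ω : Config | ∀ y ∈ S, ω (-(y : ℤ)) = 0}
      = ((S.image fun y : ℕ => -(y : ℤ) : Finset ℤ) : Set ℤ).pi fun _ => {0} := by
    ext ω; simp [Set.mem_pi]
  have h0 : siteMeasure q {0} = ENNReal.ofReal q := by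
    rw [siteMeasure, bernoulliMeasure_apply_of_mem_of_notMem q (measurableSet_singleton _)
      (Set.mem_singleton _) (by decide)]
    rw [ENNReal.ofReal, Real.toNNReal_of_nonneg q.2.1]
    rfl
  rw [e, Measure.infinitePi_pi _ fun _ _ => measurableSet_singleton _, Finset.prod_const, h0,
    Finset.card_image_of_injective _ fun a b h => by simpa using h,
    ENNReal.ofReal_pow q.2.1]

theorem measurableSet_forall_empty (S : Finset ℕ) :
    MeasurableSet {ω : Config | ∀ y ∈ S, ω (-(y : ℤ)) = 0} := by
  have e : {ω : Config | ∀ y ∈ S, ω (-(y : ℤ)) = 0}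
      = ⋂ y ∈ S, (fun ω : Config => ω (-(y : ℤ))) ⁻¹' {0} := by ext ω; simp
  rw [e]
  exact S.measurableSet_biInter fun y _ => measurable_pi_apply _ (measurableSet_singleton _)

theorem dirichletForm_testFunction_le (q : unitInterval) (n N : ℕ) :
    dirichletForm q (testFunction n N) ≤
      ENNReal.ofReal (N * (q ^ (n + 1) * ((goodSets n n).card : ℝ))) := by
  have hsite : ∀ x ∈ Finset.Icc 1 N,
      ∫⁻ ω, ENNReal.ofReal (siteEnergy q (-(x : ℤ)) (testFunction n N) ω) ∂(equilibrium q)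
        ≤ ENNReal.ofReal (q ^ (n + 1) * ((goodSets n n).card : ℝ)) := by
    intro x hx
    rw [Finset.mem_Icc] at hx
    calc _ ≤ ∫⁻ ω, ENNReal.ofReal q * ∑ S ∈ goodSets n n,
          {ω : Config | ∀ y ∈ S, ω (-(y : ℤ)) = 0}.indicator (fun _ => (1 : ℝ≥0∞)) ω
            ∂(equilibrium q) := by
          refine lintegral_mono fun ω => ?_
          refine (ENNReal.ofReal_le_ofReal
            (siteEnergy_testFunction_le q.2 n N hx.1 hx.2 ω)).trans_eq ?_
          rw [ENNReal.ofReal_mul q.2.1, ENNReal.ofReal_sum_of_nonneg fun S _ =>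
            Set.indicator_nonneg (fun _ _ => zero_le_one) _]
          congr 1
          refine Finset.sum_congr rfl fun S _ => ?_
          simp only [Set.indicator]
          split_ifs <;> simp
      _ = ENNReal.ofReal q * ∑ S ∈ goodSets n n, ENNReal.ofReal ((q : ℝ) ^ n) := by
          rw [lintegral_const_mul' _ _ ENNReal.ofReal_ne_top, lintegral_finsetSum]
          · congr 1
            refine Finset.sum_congr rfl fun S hS => ?_
            rw [lintegral_indicator_const (measurableSet_forall_empty S), one_mul,
              equilibrium_forall_empty, card_of_mem_goodSets hS]
          · exact fun S _ => measurable_const.indicator (measurableSet_forall_empty S)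
      _ = _ := by
          rw [Finset.sum_const, nsmul_eq_mul, ← ENNReal.ofReal_natCast,
            ← ENNReal.ofReal_mul (by positivity), ← ENNReal.ofReal_mul q.2.1]
          congr 1
          ring
  rw [dirichletForm_eq, tsum_eq_sum (s := (Finset.Icc 1 N).image fun x : ℕ => -(x : ℤ))
    fun x hx => by rw [siteEnergy_testFunction_of_notMem n N hx]; simp,
    Finset.sum_image fun a _ b _ h => by simpa using h]
  refine (Finset.sum_le_card_nsmul _ _ _ hsite).trans_eq ?_
  rw [Nat.card_Icc, Nat.add_sub_cancel, nsmul_eq_mul, ← ENNReal.ofReal_natCast,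
    ← ENNReal.ofReal_mul (by positivity)]

theorem full_le_testFunction (n N : ℕ) : full (-(N : ℤ)) N ≤ testFunction n N := by
  intro ω
  by_cases h : ∃ x, 1 ≤ x ∧ x ≤ N ∧ ω (-(x : ℤ)) = 0
  · obtain ⟨x, hx1, hxN, hx⟩ := h
    have : full (-(N : ℤ)) N ω = 0 := by
      rw [full, Finset.prod_apply]
      refine Finset.prod_eq_zero (Finset.mem_range.2 (show N - x < N by omega)) ?_
      have e : -(N : ℤ) + ((N - x : ℕ) : ℤ) = -(x : ℤ) := by omega
      simp [e, emp, hx]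
    rw [this, testFunction]
    split_ifs <;> norm_num
  · have he : emptySet N ω = ∅ := by
      rw [Finset.eq_empty_iff_forall_notMem]
      intro x hx
      obtain ⟨⟨h1, h2⟩, h3⟩ := mem_emptySet.1 hx
      exact h ⟨x, h1, h2, h3⟩
    have : ω ∈ bottleneckSet n N := ⟨0, Nat.zero_le _, by simp [he, goodSets]⟩
    rw [testFunction, if_pos this]
    exact full_le_one _ _ ω

theorem testFunction_le (n : ℕ) : testFunction n (2 ^ n) ≤ 1 - emp (-((2 ^ n : ℕ) : ℤ)) := by
  intro ω
  by_cases h : ω (-((2 ^ n : ℕ) : ℤ)) = 0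
  · have : ω ∉ bottleneckSet n (2 ^ n) := by
      rintro ⟨m, hm, hω⟩
      have := add_le_of_mem_goodSets hm hω
        (mem_emptySet.2 ⟨⟨Nat.one_le_two_pow, le_rfl⟩, h⟩)
      have := Nat.one_le_two_pow (n := n - m)
      omega
    simp only [testFunction, if_neg this, Pi.sub_apply, Pi.one_apply]
    exact sub_nonneg.2 (emp_le_one _ ω)
  · have e : emp (-((2 ^ n : ℕ) : ℤ)) ω = 0 := by simp only [emp, h, if_false]
    simp only [Pi.sub_apply, e, Pi.one_apply, testFunction]
    split_ifs <;> norm_num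

theorem measurable_full (a : ℤ) (n : ℕ) : Measurable (full a n) := by
  induction n with
  | zero => rw [full_zero]; exact measurable_const
  | succ n ih => rw [full_succ]; exact ih.mul (measurable_const.sub (measurable_emp _))

/-- The variance of an indicator of mean `m` is `m (1 - m)`: the fully occupied interval lies in the
event, and an empty site at `-2^n` excludes it. -/
theorem le_variance_testFunction {q : unitInterval} (h0 : 0 < q) (h1 : q < 1) (n : ℕ) :
    q * (1 - q : ℝ) ^ (2 ^ n) ≤ variance (testFunction n (2 ^ n)) (equilibrium q) := by
  set N := 2 ^ n
  have hq0 : (0 : ℝ) < q := h0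
  have hq1 : (q : ℝ) < 1 := h1
  have hL := memLp_of_dependsOn q (dependsOn_testFunction n N)
  have hint := hL.integrable one_le_two
  have hfull : Integrable (full (-(N : ℤ)) N) (equilibrium q) := by
    refine Integrable.of_bound ?_ 1 (Eventually.of_forall fun ω => ?_)
    · exact (measurable_full _ N).aestronglyMeasurable
    · rw [Real.norm_of_nonneg (full_nonneg _ _ ω)]
      exact full_le_one _ _ ω
  have hemp : Integrable (emp (-(N : ℤ))) (equilibrium q) := by
    have := integrable_emp_mul (q := q) (g := 1) (integrable_const 1) (-(N : ℤ))
    rwa [mul_one] at this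
  set m := ∫ ω, testFunction n N ω ∂(equilibrium q) with hm
  have l1 : (1 - q : ℝ) ^ N ≤ m := by
    have := integral_mono hfull hint (full_le_testFunction n N)
    rw [← integral_blockAvg h0 h1 hfull (-(N : ℤ)) N, blockAvg_full q.2] at this
    simpa using this
  have l2 : m ≤ 1 - q := by
    have := integral_mono hint ((integrable_const 1).sub hemp) (testFunction_le n)
    simp only [Pi.sub_apply] at this
    rwa [integral_sub (integrable_const 1) hemp, integral_emp h0 h1, integral_const,
      probReal_univ, one_smul] at this
  have hv : variance (testFunction n N) (equilibrium q) = m - m ^ 2 := by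
    rw [variance_eq_sub hL]
    congr 1
    refine integral_congr_ae (Eventually.of_forall fun ω => ?_)
    simp only [Pi.pow_apply, testFunction]
    split_ifs <;> norm_num
  have l0 : 0 < (1 - q : ℝ) ^ N := pow_pos (by linarith) _
  rw [hv]
  nlinarith

/-! ### Two-sided bounds on the spectral gap -/

theorem dependsOn_localGenerator (q : unitInterval) {φ : Config → ℝ} {Λ : Finset ℤ}
    (h : DependsOn φ (Λ : Set ℤ)) :
    DependsOn (localGenerator q φ) ((Λ ∪ Λ.image (· + 1) : Finset ℤ) : Set ℤ) := by
  intro ω ω' hω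
  refine finsum_congr fun x => ?_
  have hΛ : ∀ i ∈ Λ, ω i = ω' i := fun i hi =>
    hω i (Finset.mem_coe.2 (Finset.mem_union_left _ hi))
  have hφ : φ ω = φ ω' := h hΛ
  have hint : ∀ s, φ (Function.update ω x s) = φ (Function.update ω' x s) := fun s =>
    h fun i hi => by
      rcases eq_or_ne i x with rfl | hix
      · simp
      · rw [Function.update_of_ne hix, Function.update_of_ne hix, hΛ i hi]
  by_cases hx : x ∈ Λ
  · have hc : ω (x + 1) = ω' (x + 1) :=
      hω (x + 1) (Finset.mem_coe.2
        (Finset.mem_union_right _ (Finset.mem_image_of_mem (· + 1) hx)))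
    have hiff : ω ∈ constraintSet x ↔ ω' ∈ constraintSet x := by
      simp only [constraintSet, Set.mem_ofPred_eq, hc]
    by_cases hω' : ω' ∈ constraintSet x
    · rw [Set.indicator_of_mem hω', Set.indicator_of_mem (hiff.2 hω'), hφ]
      simp only [hint]
    · rw [Set.indicator_of_notMem hω', Set.indicator_of_notMem (mt hiff.1 hω')]
  · have hz : ∀ ω s, φ (Function.update ω x s) = φ ω := fun ω s => h fun i hi => by
      rw [Function.update_of_ne]
      rintro rfl
      exact hx hi
    simp [Set.indicator, hz]

theorem toLp_mem_generatorDomain (q : unitInterval) {φ : Config → ℝ} {Λ : Finset ℤ}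
    (h : DependsOn φ (Λ : Set ℤ)) :
    (memLp_of_dependsOn q h).toLp φ ∈ generatorDomain q :=
  ⟨(memLp_of_dependsOn q (dependsOn_localGenerator q h)).toLp _, subset_closure
    ⟨φ, ⟨Λ, h⟩, (memLp_of_dependsOn q h).coeFn_toLp,
      (memLp_of_dependsOn q (dependsOn_localGenerator q h)).coeFn_toLp⟩⟩

theorem dirichletForm_congr {q : unitInterval} (h0 : 0 < q) (h1 : q < 1) {f g : Config → ℝ}
    (h : f =ᵐ[equilibrium q] g) : dirichletForm q f = dirichletForm q g := by
  rw [dirichletForm_eq, dirichletForm_eq]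
  refine tsum_congr fun x => lintegral_congr_ae ?_
  have hs : ∀ s, ∀ᵐ ω ∂(equilibrium q), f (Function.update ω x s) = g (Function.update ω x s) :=
    fun s => ae_of_ae_map (measurable_update_const x s).aemeasurable
      ((map_update_absolutelyContinuous h0 h1 x s).ae_le h)
  filter_upwards [hs 0, hs 1] with ω e0 e1
  simp [siteEnergy, cvar, siteAvg_apply, e0, e1]

theorem le_evariance_of_mem_generatorDomain {q : unitInterval} (h0 : 0 < q) (h1 : q < 1) {C : ℝ}
    (hC : 0 < C) {ℓ : ℕ} (hℓ : 1 ≤ ℓ) (hP : ∀ m : ℕ, Poincare q (ℓ + m * ℓ) C)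
    {f : Lp ℝ 2 (equilibrium q)} (hf : f ∈ generatorDomain q)
    (hne : ¬ ∃ a : ℝ, f =ᵐ[equilibrium q] fun _ => a) :
    ENNReal.ofReal (q / (4 * C)) ≤ dirichletForm q f / evariance f (equilibrium q) := by
  have hfm : Measurable f := (Lp.stronglyMeasurable f).measurable
  have hL := Lp.memLp f
  have hv : evariance f (equilibrium q) ≠ 0 := fun h =>
    hne ⟨_, (evariance_eq_zero_iff hfm.aemeasurable).1 h⟩
  rw [ENNReal.le_div_iff_mul_le (Or.inl hv) (Or.inl hL.evariance_ne_top)]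
  exact evariance_le_of_poincare h0 h1 hC hℓ hP hfm hL fun ε hε =>
    exists_approx_of_mem_generatorDomain hf hε

theorem iInf_le_testFunction {q : unitInterval} (h0 : 0 < q) (h1 : q < 1) (n : ℕ) :
    (⨅ f ∈ {f ∈ generatorDomain q | ¬ ∃ a : ℝ, f =ᵐ[equilibrium q] fun _ => a},
      dirichletForm q f / evariance f (equilibrium q)) ≤
    ENNReal.ofReal (2 ^ n * q ^ n * ((goodSets n n).card : ℝ) / (1 - q) ^ (2 ^ n)) := by
  have hq0 : (0 : ℝ) < q := h0
  have hq1 : (0 : ℝ) < 1 - q := sub_pos.2 h1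
  set φ := testFunction n (2 ^ n)
  have hdep := dependsOn_testFunction n (2 ^ n)
  have hL := memLp_of_dependsOn q hdep
  set f := hL.toLp φ
  have hfφ : f =ᵐ[equilibrium q] φ := MemLp.coeFn_toLp hL
  have hvar := le_variance_testFunction h0 h1 n
  have hpos : 0 < (q : ℝ) * (1 - q : ℝ) ^ (2 ^ n) := by positivity
  have hev : ENNReal.ofReal (q * (1 - q : ℝ) ^ (2 ^ n)) ≤ evariance f (equilibrium q) := by
    rw [evariance_congr hfφ, ← ofReal_variance hL]
    exact ENNReal.ofReal_le_ofReal hvar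
  have hne : ¬ ∃ a : ℝ, f =ᵐ[equilibrium q] fun _ => a := by
    rintro ⟨a, ha⟩
    have h2 : evariance f (equilibrium q) = 0 := by
      rw [evariance_congr ha, evariance_eq_zero_iff measurable_const.aemeasurable]
      simp
    rw [h2] at hev
    exact absurd hev (by simpa using hpos)
  refine (iInf₂_le f ⟨toLp_mem_generatorDomain q hdep, hne⟩).trans ?_
  have hD := dirichletForm_testFunction_le q n (2 ^ n)
  rw [dirichletForm_congr h0 h1 hfφ]
  refine (ENNReal.div_le_div hD hev).trans_eq ?_
  rw [← ENNReal.ofReal_div_of_pos hpos]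
  congr 1
  push_cast
  field_simp
  ring

theorem le_spectralGap {q : unitInterval} (h0 : 0 < q) (h1 : q < 1) {C : ℝ}
    (hC : 0 < C) {ℓ : ℕ} (hℓ : 1 ≤ ℓ) (hP : ∀ m : ℕ, Poincare q (ℓ + m * ℓ) C) :
    q / (4 * C) ≤ spectralGap q := by
  -- Finiteness is essential, since `toReal` sends `⊤` to `0`; the test function with `n = 0`
  -- suffices.
  have hne : (⨅ f ∈ {f ∈ generatorDomain q | ¬ ∃ a : ℝ, f =ᵐ[equilibrium q] fun _ => a},
      dirichletForm q f / evariance f (equilibrium q)) ≠ ⊤ :=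
    ((iInf_le_testFunction h0 h1 0).trans_lt ENNReal.ofReal_lt_top).ne
  rw [spectralGap, ← ENNReal.ofReal_le_iff_le_toReal hne]
  exact le_iInf₂ fun f hf => le_evariance_of_mem_generatorDomain h0 h1 hC hℓ hP hf.1 hf.2

theorem spectralGap_le {q : unitInterval} (h0 : 0 < q) (h1 : q < 1) (n : ℕ) :
    spectralGap q ≤ 2 ^ n * q ^ n * ((goodSets n n).card : ℝ) / (1 - q) ^ (2 ^ n) := by
  have hq0 : (0 : ℝ) < q := h0
  have hq1 : (0 : ℝ) < 1 - q := sub_pos.2 h1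
  exact ENNReal.toReal_le_of_le_ofReal (by positivity) (iInf_le_testFunction h0 h1 n)

/-! ### Explicit exponents and the limit -/

/-- Lower bound on the gap with an explicit leading exponent. -/
theorem exists_exp_le_spectralGap {η : ℝ} (hη0 : 0 < η) (hη1 : η < 1) :
    ∃ A B : ℝ, ∀ q : unitInterval, 0 < q → q < 1 →
      Real.exp (-(Real.log (1 / q) ^ 2 / (2 * Real.log (2 - η)) + A * Real.log (1 / q) + B))
        ≤ spectralGap q := by
  obtain ⟨A, B, h⟩ := exists_uniform_poincare hη0 hη1
  refine ⟨A + 1, B + Real.log 4, fun q h0 h1 => ?_⟩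
  have hq0 : (0 : ℝ) < q := h0
  obtain ⟨C, hC, hCle, ℓ, hℓ, hP⟩ := h q h0 h1
  refine le_trans ?_ (le_spectralGap h0 h1 hC hℓ hP)
  have hL : Real.exp (Real.log (1 / q)) = 1 / q := Real.exp_log (by positivity)
  set L := Real.log (1 / (q : ℝ))
  have e : Real.exp (-(L ^ 2 / (2 * Real.log (2 - η)) + (A + 1) * L + (B + Real.log 4)))
      = q / (4 * Real.exp (L ^ 2 / (2 * Real.log (2 - η)) + A * L + B)) := by
    have : L ^ 2 / (2 * Real.log (2 - η)) + (A + 1) * L + (B + Real.log 4)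
        = L + (Real.log 4 + (L ^ 2 / (2 * Real.log (2 - η)) + A * L + B)) := by ring
    rw [this, Real.exp_neg, Real.exp_add, Real.exp_add, hL, Real.exp_log (by norm_num)]
    field_simp
  rw [e]
  exact div_le_div_of_nonneg_left hq0.le (by positivity)
    (mul_le_mul_of_nonneg_left hCle (by norm_num))

theorem exists_mul_rpow_le_spectralGap {δ : ℝ} (hδ0 : 0 < δ) (hδ1 : δ < 1) :
    ∃ C : ℝ, 0 < C ∧ ∀ q : unitInterval, 0 < q → q < 1 →
      C * (q : ℝ) ^ (Real.logb 2 (1 / (q : ℝ)) / (2 - δ)) ≤ spectralGap q := by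
  set c := Real.log 2 with hc
  have hc0 : 0 < c := Real.log_pos (by norm_num)
  have hpow1 : (1 : ℝ) < 2 ^ (1 - δ / 4) :=
    Real.one_lt_rpow (by norm_num) (by linarith)
  have hpow2 : (2 : ℝ) ^ (1 - δ / 4) < 2 := by
    conv_rhs => rw [← Real.rpow_one 2]
    exact Real.rpow_lt_rpow_of_exponent_lt (by norm_num) (by linarith)
  -- With this `η`, `2 log (2 - η) = (2 - δ / 2) log 2` exceeds `(2 - δ) log 2`. The resulting slack
  -- `κ L²` absorbs the linear term `A L` uniformly in `q`.
  obtain ⟨A, B, h⟩ := exists_exp_le_spectralGap (η := 2 - 2 ^ (1 - δ / 4)) (by linarith)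
    (by linarith)
  have hb : Real.log (2 - (2 - 2 ^ (1 - δ / 4))) = (1 - δ / 4) * c := by
    rw [sub_sub_cancel, Real.log_rpow (by norm_num)]
  rw [hb] at h
  set κ := 1 / ((2 - δ) * c) - 1 / (2 * ((1 - δ / 4) * c)) with hκ
  have hκ0 : 0 < κ := by
    rw [hκ, sub_pos]
    refine one_div_lt_one_div_of_lt (mul_pos (by linarith) hc0) ?_
    nlinarith
  refine ⟨Real.exp (-(A ^ 2 / (4 * κ) + B)), Real.exp_pos _, fun q h0 h1 => le_trans ?_ (h q h0 h1)⟩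
  have hq0 : (0 : ℝ) < q := h0
  set L := Real.log (1 / (q : ℝ)) with hL
  have hlog : Real.log q = -L := by rw [hL, one_div, Real.log_inv, neg_neg]
  rw [Real.rpow_def_of_pos hq0, hlog, Real.logb, ← hL, ← hc, ← Real.exp_add]
  refine Real.exp_le_exp.2 ?_
  have e1 : -L * (L / c / (2 - δ)) = -(1 / ((2 - δ) * c) * L ^ 2) := by
    have : 2 - δ ≠ 0 := by linarith
    field_simp
  have e2 : L ^ 2 / (2 * ((1 - δ / 4) * c)) = 1 / ((2 - δ) * c) * L ^ 2 - κ * L ^ 2 := by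
    rw [hκ]; ring
  have e3 : A * L ≤ κ * L ^ 2 + A ^ 2 / (4 * κ) := by
    have : κ * L ^ 2 + A ^ 2 / (4 * κ) - A * L = (2 * κ * L - A) ^ 2 / (4 * κ) := by
      field_simp; ring
    have := div_nonneg (sq_nonneg (2 * κ * L - A)) (show 0 ≤ 4 * κ by positivity)
    linarith
  rw [e1, e2]
  linarith

theorem card_goodSets_self_le (n : ℕ) :
    ((goodSets n n).card : ℝ) ≤ (n : ℝ) ^ n * 2 ^ (∑ i ∈ Finset.range n, i) := by
  have h := card_goodSets_le n n
  rw [Finset.prod_mul_distrib, Finset.prod_pow_eq_pow_sum] at h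
  have h1 : ∏ i ∈ Finset.range n, (i + 1) ≤ n ^ n := by
    refine (Finset.prod_le_pow_card _ _ n fun i hi => ?_).trans_eq (by simp)
    exact Finset.mem_range.1 hi
  have h2 : ∑ i ∈ Finset.range n, (n - (i + 1)) = ∑ i ∈ Finset.range n, i := by
    rw [← Finset.sum_range_reflect]
    refine Finset.sum_congr rfl fun i hi => ?_
    have := Finset.mem_range.1 hi
    omega
  rw [h2] at h
  exact_mod_cast h.trans (Nat.mul_le_mul_right _ h1)

theorem le_log_one_div_spectralGap {q : unitInterval} (h0 : 0 < q) (h1 : q < 1)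
    (hgap : 0 < spectralGap q) (hL : 2 * Real.log 2 ≤ Real.log (1 / (q : ℝ))) :
    Real.log (1 / q) ^ 2 / (2 * Real.log 2) - 3 / 2 * Real.log (1 / q) - Real.log 2
      - Real.log (1 / q) / Real.log 2 * Real.log (Real.log (1 / q) / Real.log 2)
      ≤ Real.log (1 / spectralGap q) := by
  have hq0 : (0 : ℝ) < q := h0
  have hq1 : (0 : ℝ) < 1 - q := sub_pos.2 h1
  set c := Real.log 2 with hc
  have hc0 : 0 < c := Real.log_pos (by norm_num)
  set L := Real.log (1 / (q : ℝ)) with hLdef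
  have hlogq : Real.log q = -L := by rw [hLdef, one_div, Real.log_inv, neg_neg]
  have hLc : 2 ≤ L / c := by rwa [le_div_iff₀ hc0]
  -- One below the scale where `2^n q` is about `1`: then `2^n q ≤ 1 / 2`, and Bernoulli's
  -- inequality keeps `(1 - q) ^ (2^n)` above `1 / 2`.
  obtain ⟨n, hn⟩ : ∃ n : ℕ, ⌊L / c⌋₊ = n + 1 :=
    ⟨⌊L / c⌋₊ - 1, by have : 2 ≤ ⌊L / c⌋₊ := Nat.le_floor (by exact_mod_cast hLc); omega⟩
  have hn1 : (n : ℝ) + 1 ≤ L / c := by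
    have := Nat.floor_le (show 0 ≤ L / c by linarith)
    rw [hn] at this; exact_mod_cast this
  have hn2 : L / c < (n : ℝ) + 2 := by
    have := Nat.lt_floor_add_one (L / c)
    rw [hn] at this
    push_cast at this
    linarith
  have hnpos : 0 < n := by
    by_contra h
    have : n = 0 := by omega
    rw [this] at hn2
    norm_num at hn2
    linarith
  have hn1' : (n + 1) * c ≤ L := by rwa [le_div_iff₀ hc0] at hn1
  have hn2' : L < (n + 2) * c := by rwa [div_lt_iff₀ hc0] at hn2
  have h2n : (2 : ℝ) ^ n * q ≤ 1 / 2 := by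
    rw [← Real.log_le_log_iff (by positivity) (by norm_num),
      Real.log_mul (by positivity) hq0.ne', Real.log_pow, hlogq, one_div, Real.log_inv, ← hc]
    linarith
  have hden : (1 / 2 : ℝ) ≤ (1 - q) ^ (2 ^ n) := by
    have := one_add_mul_le_pow (a := -(q : ℝ)) (by linarith) (2 ^ n)
    push_cast at this
    rw [← sub_eq_add_neg] at this
    linarith
  have hnr : (0 : ℝ) < n := by exact_mod_cast hnpos
  have hle : spectralGap q
      ≤ 2 * (2 ^ n * q ^ n * ((n : ℝ) ^ n * 2 ^ (∑ i ∈ Finset.range n, i))) := by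
    refine (spectralGap_le h0 h1 n).trans ?_
    rw [div_le_iff₀ (by positivity)]
    have hcard := mul_le_mul_of_nonneg_left (card_goodSets_self_le n)
      (show (0 : ℝ) ≤ 2 ^ n * q ^ n by positivity)
    refine hcard.trans ?_
    have := mul_le_mul_of_nonneg_left hden
      (show (0 : ℝ) ≤ 2 * (2 ^ n * q ^ n * ((n : ℝ) ^ n * 2 ^ (∑ i ∈ Finset.range n, i))) by
        positivity)
    linarith
  have hlog := Real.log_le_log hgap hle
  have hsum : ((∑ i ∈ Finset.range n, i : ℕ) : ℝ) = n * (n - 1) / 2 := by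
    have := Finset.sum_range_id_mul_two n
    have h3 : ((∑ i ∈ Finset.range n, i : ℕ) : ℝ) * 2 = n * (n - 1) := by
      rw [← Nat.cast_two, ← Nat.cast_mul, this, Nat.cast_mul, Nat.cast_sub hnpos, Nat.cast_one]
    linarith
  rw [Real.log_mul (by norm_num) (by positivity), Real.log_mul (by positivity) (by positivity),
    Real.log_mul (by positivity) (by positivity), Real.log_mul (by positivity) (by positivity),
    Real.log_pow, Real.log_pow, Real.log_pow, Real.log_pow, hsum, hlogq, ← hc] at hlog
  rw [one_div (spectralGap q), Real.log_inv]
  have hnlog : (n : ℝ) * Real.log n ≤ L / c * Real.log (L / c) := by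
    refine mul_le_mul (by linarith) (Real.log_le_log hnr (by linarith))
      (Real.log_nonneg (by exact_mod_cast hnpos)) (by linarith)
  have hL0 : 0 < L := by linarith
  -- The quadratic in `n` is nearly maximal at `n = L / c`; rounding down by less than `2` loses at
  -- most `L`.
  have key : L ^ 2 / (2 * c) - L ≤ n * (L - n * c / 2) := by
    have e : L ^ 2 / (2 * c) - L = (L / c - 2) * (L / 2) := by field_simp
    rw [e]
    refine mul_le_mul (by linarith) (by linarith) (by linarith) hnr.le
  nlinarith

theorem tendsto_log_one_div :
    Tendsto (fun q : unitInterval => Real.log (1 / (q : ℝ))) (𝓝[>] (0 : unitInterval)) atTop := by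
  have h1 : Tendsto (fun q : unitInterval => (q : ℝ)) (𝓝[>] (0 : unitInterval)) (𝓝[>] (0 : ℝ)) := by
    refine tendsto_nhdsWithin_iff.2 ⟨?_, ?_⟩
    · exact (continuous_subtype_val.tendsto' (0 : unitInterval) 0 rfl).mono_left
        nhdsWithin_le_nhds
    · filter_upwards [self_mem_nhdsWithin] with q hq
      exact hq
  simp only [one_div]
  exact Real.tendsto_log_atTop.comp (tendsto_inv_nhdsGT_zero.comp h1)

theorem eventually_mem_Ioo : ∀ᶠ q : unitInterval in 𝓝[>] (0 : unitInterval), 0 < q ∧ q < 1 := by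
  filter_upwards [self_mem_nhdsWithin, mem_nhdsWithin_of_mem_nhds
    (Iio_mem_nhds (show (0 : unitInterval) < 1 from zero_lt_one))] with q h0 h1
  exact ⟨h0, h1⟩

theorem spectralGap_pos {q : unitInterval} (h0 : 0 < q) (h1 : q < 1) : 0 < spectralGap q := by
  obtain ⟨C, hC, h⟩ := exists_mul_rpow_le_spectralGap (δ := 1 / 2) (by norm_num) (by norm_num)
  have hq0 : (0 : ℝ) < q := h0
  exact lt_of_lt_of_le (by positivity) (h q h0 h1)

theorem log_one_div_spectralGap_le {δ C : ℝ} (hδ1 : δ < 1) (hC : 0 < C) {q : unitInterval}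
    (h0 : 0 < q) (h : C * (q : ℝ) ^ (Real.logb 2 (1 / (q : ℝ)) / (2 - δ)) ≤ spectralGap q) :
    Real.log (1 / spectralGap q)
      ≤ Real.log (1 / q) ^ 2 * ((2 - δ) * Real.log 2)⁻¹ - Real.log C := by
  have hq0 : (0 : ℝ) < q := h0
  have hlogq : Real.log q = -Real.log (1 / q) := by rw [one_div, Real.log_inv, neg_neg]
  have h2 := Real.log_le_log (by positivity) h
  have hc0 : 0 < Real.log 2 := Real.log_pos (by norm_num)
  rw [Real.log_mul hC.ne' (by positivity), Real.log_rpow hq0, Real.logb, hlogq] at h2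
  rw [one_div (spectralGap q), Real.log_inv]
  have e : Real.log (1 / q) / Real.log 2 / (2 - δ) * -Real.log (1 / (q : ℝ))
      = -(Real.log (1 / q) ^ 2 * ((2 - δ) * Real.log 2)⁻¹) := by
    have : 2 - δ ≠ 0 := by linarith
    field_simp
  rw [e] at h2
  linarith

theorem tendsto_log_spectralGap :
    Tendsto (fun q : unitInterval =>
        Real.log (1 / spectralGap q) / (Real.log (1 / (q : ℝ))) ^ 2)
      (𝓝[>] (0 : unitInterval)) (𝓝 ((2 * Real.log 2)⁻¹)) := by
  set c := Real.log 2 with hc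
  have hc0 : 0 < c := Real.log_pos (by norm_num)
  have hLtop := tendsto_log_one_div
  have hinv := tendsto_inv_atTop_zero.comp hLtop
  have hLpos := hLtop.eventually_ge_atTop (max 1 (2 * c))
  refine tendsto_order.2 ⟨fun a ha => ?_, fun a ha => ?_⟩
  · have hlog : Tendsto (fun q : unitInterval =>
        Real.log (Real.log (1 / (q : ℝ)) / c) / (Real.log (1 / (q : ℝ)) / c))
        (𝓝[>] (0 : unitInterval)) (𝓝 0) :=
      Real.isLittleO_log_id_atTop.tendsto_div_nhds_zero.comp (hLtop.atTop_div_const hc0)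
    have hlim : Tendsto (fun q : unitInterval => (2 * c)⁻¹
        - 3 / 2 * (Real.log (1 / (q : ℝ)))⁻¹
        - c * ((Real.log (1 / (q : ℝ)))⁻¹ * (Real.log (1 / (q : ℝ)))⁻¹)
        - (c * c)⁻¹ * (Real.log (Real.log (1 / (q : ℝ)) / c) / (Real.log (1 / (q : ℝ)) / c)))
        (𝓝[>] (0 : unitInterval))
        (𝓝 ((2 * c)⁻¹ - 3 / 2 * 0 - c * (0 * 0) - (c * c)⁻¹ * 0)) :=
      ((tendsto_const_nhds.sub (hinv.const_mul _)).sub ((hinv.mul hinv).const_mul _)).sub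
        (hlog.const_mul _)
    have hev := hlim.eventually_const_lt (show a < _ by simpa using ha)
    filter_upwards [hev, hLpos, eventually_mem_Ioo] with q h2 h3 ⟨h0, h1⟩
    have hL1 : 1 ≤ Real.log (1 / (q : ℝ)) := (le_max_left _ _).trans h3
    refine h2.trans_le ?_
    have key := le_log_one_div_spectralGap h0 h1 (spectralGap_pos h0 h1)
      ((le_max_right _ _).trans h3)
    rw [← hc] at key
    set L := Real.log (1 / (q : ℝ))
    have hL0 : 0 < L := by linarith
    rw [le_div_iff₀ (by positivity)]
    refine le_trans (le_of_eq ?_) key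
    field_simp
  -- Given `a`, `δ` is fixed first so that the leading coefficient is below `a`; then `log C` is
  -- negligible against `L²`.
  · have hcont : Tendsto (fun δ : ℝ => ((2 - δ) * c)⁻¹) (𝓝[>] 0) (𝓝 (((2 - 0) * c)⁻¹)) := by
      refine Tendsto.mono_left (ContinuousAt.tendsto ?_) nhdsWithin_le_nhds
      refine ContinuousAt.inv₀ (by fun_prop) ?_
      simpa using hc0.ne'
    have hev := hcont.eventually_lt_const (show _ < a by simpa using ha)
    obtain ⟨δ, hδa, hδ0, hδ1⟩ := (hev.and (Ioo_mem_nhdsGT (show (0 : ℝ) < 1 by norm_num))).exists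
    obtain ⟨C, hC, h⟩ := exists_mul_rpow_le_spectralGap hδ0 hδ1
    have hlim : Tendsto (fun q : unitInterval => ((2 - δ) * c)⁻¹
        - Real.log C * ((Real.log (1 / (q : ℝ)))⁻¹ * (Real.log (1 / (q : ℝ)))⁻¹))
        (𝓝[>] (0 : unitInterval)) (𝓝 (((2 - δ) * c)⁻¹ - Real.log C * (0 * 0))) :=
      tendsto_const_nhds.sub ((hinv.mul hinv).const_mul _)
    have hev2 := hlim.eventually_lt_const (show _ < a by simpa using hδa)
    filter_upwards [hev2, hLpos, eventually_mem_Ioo] with q h2 h3 ⟨h0, h1⟩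
    have hL1 : 1 ≤ Real.log (1 / (q : ℝ)) := (le_max_left _ _).trans h3
    refine lt_of_le_of_lt ?_ h2
    have key := log_one_div_spectralGap_le hδ1 hC h0 (h q h0 h1)
    rw [← hc] at key
    set L := Real.log (1 / (q : ℝ))
    have hL0 : 0 < L := by linarith
    rw [div_le_iff₀ (by positivity)]
    refine key.trans (le_of_eq ?_)
    field_simp

end EastModel

theorem mainTheorem5 :
    (∀ q : unitInterval, 0 < q → q < 1 → 0 < EastModel.spectralGap q) ∧
    (∀ δ : ℝ, 0 < δ → δ < 1 → ∃ C : ℝ, 0 < C ∧ ∀ q : unitInterval, 0 < q → q < 1 →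
      C * (q : ℝ) ^ (Real.logb 2 (1 / (q : ℝ)) / (2 - δ)) ≤ EastModel.spectralGap q) ∧
    Tendsto
      (fun q : unitInterval =>
        Real.log (1 / EastModel.spectralGap q) / (Real.log (1 / (q : ℝ))) ^ 2)
      (𝓝[>] (0 : unitInterval)) (𝓝 ((2 * Real.log 2)⁻¹)) :=
  ⟨fun _ h0 h1 => EastModel.spectralGap_pos h0 h1,
    fun _ h0 h1 => EastModel.exists_mul_rpow_le_spectralGap h0 h1,
    EastModel.tendsto_log_spectralGap⟩
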